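/- Let $T>0$, let $\mathbb X$ be a real Hilbert space with dual $\mathbb X'$, let $U$ be a separable metric space, let $E\subseteq\mathbb X$ be closed and convex, let $y_0\in\mathbb X$, and let $A:\mathcal D(A)\subseteq\mathbb X\to\mathbb X$ generate a $C_0$-semigroup $S(\cdot)$ on $\mathbb X$. Let $F:[0,T]\times\mathbb X\times U\to\mathbb X$ and $g:[0,T]\times\mathbb X\times U\to\mathbb R$ be strongly measurable in $t\in(0,T)$ and continuously Fréchet differentiable in $y\in\mathbb X$, with $F(t,\cdot,\cdot)$, $F_y(t,\cdot,\cdot)$, $g(t,\cdot,\cdot)$, $g_y(t,\cdot,\cdot)$ continuous for each $t$, and suppose there is $L>0$ with $$|F_y(t,y,u)|_{\mathcal L(\mathbb X)}+|g_y(t,y,u)|_{\mathbb X'}+|F(t,0,u)|_{\mathbb X}+|g(t,0,u)|\le L\qquad\text{for all }(t,y,u)\in[0,T]\times\mathbb X\times U.$$ Let $\mathcal U_1(0,T)$ be the set of measurable functions $u:(0,T)\to U$, with the Ekeland metric $d(u,v)=|\{t\in(0,T): u(t)\ne v(t)\}|$ (Lebesgue measure). For $u\in\mathcal U_1(0,T)$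 let $y(\cdot;u)\in C([0,T];\mathbb X)$ be the mild solution of $$y_t(t)=Ay(t)+F(t,y(t),u(t)),\quad t\in[0,T],\qquad y(0)=y_0,$$ and put $J(u)=\int_0^T g(t,y(t;u),u(t))\,dt$. Let $\bar u\in\mathcal U_1(0,T)$ minimize $J$ over all $u\in\mathcal U_1(0,T)$ with $y(T;u)\in E$ (in particular $y(T;\bar u)\in E$), and write $\bar y=y(\cdot;\bar u)$. For $v\in\mathcal U_1(0,T)$ let $\xi(\cdot;v)$ be the mild solution of the spike-variation linearization $$\xi_t(t)=A\xi(t)+F_y(t,\bar y(t),\bar u(t))\xi(t)+F(t,\bar y(t),v(t))-F(t,\bar y(t),\bar u(t)),\quad t\in[0,T],\qquad \xi(0)=0,$$ let $$\xi^0(v)=\int_0^T\big[\langle g_y(t,\bar y(t),\bar u(t)),\xi(t;v)\rangle_{\mathbb X',\mathbb X}+g(t,\bar y(t),v(t))-g(t,\bar y(t),\bar u(t))\big]dt,$$ and set $$\mathcal V(\bar u)=\Big\{\tfrac1T\big(\xi^0(v),\xi(T;v)\big): v\in\mathcal U_1(0,T)\Big\}\subseteq\mathbb R\times\mathbb X,\qquad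 \mathcal M_1=\Big\{\tfrac1T\xi(T;v): v\in\mathcal U_1(0,T)\Big\}\subseteq\mathbb X.$$ Call a set $D\subseteq\mathbb X$ finite codimensional if there is $x_0\in\overline{\mathrm{co}}\,D$ such that the closed linear span of $D-x_0$ has finite codimension in $\mathbb X$ and $\overline{\mathrm{co}}(D-x_0)$ has an interior point relative to this closed subspace. Assume that $\mathcal M_1-E=\{m-e: m\in\mathcal M_1,\ e\in E\}$ is finite codimensional. Then there is a pair $(z_0,z)\in\mathbb R\times\mathbb X'$, $(z_0,z)\ne(0,0)$, such that $$z_0\,\xi_1+\langle z,\xi_2\rangle_{\mathbb X',\mathbb X}\ge 0\quad\forall\,(\xi_1,\xi_2)\in\mathcal V(\bar u),\qquad\qquad \langle z,x-\bar y(T)\rangle_{\mathbb X',\mathbb X}\le 0\quad\forall\,x\in E,$$ and moreover, for this pair: (i) if $z_0\ne0$, there is $\tilde z\in\mathbb X'$ with $\xi_1+\langle\tilde z,\xi_2\rangle_{\mathbb X',\mathbb X}\ge0$ for all $(\xi_1,\xi_2)\in\mathcal V(\bar u)$; (ii) if $z\ne0$, there is a sequence $\{u^k\}\subseteq\mathcal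 U_1(0,T)$ converging to $\bar u$ in the Ekeland metric such that $y(T;u^k)\notin E$ for all $k$, $\lim_{k\to\infty}\mathrm{dist}(y(T;u^k),E)=0$ and $\lim_{k\to\infty}J(u^k)=J(\bar u)$; furthermore, with $\mathcal P_E$ the metric projection onto $E$ and $\hat z\in\mathbb X$ the Riesz representative of $z$, $\mathcal P_E(y(T;u^k))\to\bar y(T)$ as $k\to\infty$ and $\big(\hat z,\,y(T;u^k)-\mathcal P_E(y(T;u^k))\big)_{\mathbb X}>0$ for all $k$. -/

import Mathlib

open MeasureTheory Set Filter Topology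
open scoped Pointwise

noncomputable section

/-- A strongly continuous (`C₀`) semigroup of bounded operators on a Banach space `X`.
It is indexed by `ℝ`, but only the values at times `t ≥ 0` are meaningful. -/
structure C0Semigroup (X : Type*) [NormedAddCommGroup X] [NormedSpace ℝ X] where
  toFun : ℝ → X →L[ℝ] X
  map_zero : toFun 0 = ContinuousLinearMap.id ℝ X
  map_add : ∀ s t : ℝ, 0 ≤ s → 0 ≤ t → toFun (s + t) = (toFun s).comp (toFun t)
  tendsto_zero : ∀ x : X, Tendsto (fun t => toFun t x) (𝓝[>] 0) (𝓝 x)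

/-- The unbounded operator `A : 𝒟(A) ⊆ X → X` is the infinitesimal generator of `S`: `x ∈ 𝒟(A)`
and `A x = w` if and only if `(S(h) x - x) / h → w` as `h → 0⁺`. -/
def IsGenerator {X : Type*} [NormedAddCommGroup X] [NormedSpace ℝ X]
    (A : X →ₗ.[ℝ] X) (S : C0Semigroup X) : Prop :=
  ∀ x w : X, (x, w) ∈ A.graph ↔
    Tendsto (fun h : ℝ => h⁻¹ • (S.toFun h x - x)) (𝓝[>] 0) (𝓝 w)

/-- `y ∈ C([0, T]; X)` is a mild solution of `y'(t) = A y(t) + φ(t, y(t))`, `y(0) = x₀`, on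
`[0, T]`, where `A` generates `S`. -/
def IsMildSolution {X : Type*} [NormedAddCommGroup X] [NormedSpace ℝ X]
    (S : C0Semigroup X) (T : ℝ) (φ : ℝ → X → X) (x₀ : X) (y : ℝ → X) : Prop :=
  ContinuousOn y (Icc 0 T) ∧
  IntegrableOn (fun s => φ s (y s)) (Ioo 0 T) volume ∧
  ∀ t ∈ Icc 0 T, y t = S.toFun t x₀ + ∫ s in (0 : ℝ)..t, S.toFun (t - s) (φ s (y s))

/-- The control set `𝒰₁(0, T)`: (Lebesgue) measurable functions `(0, T) → U`. Controls are
written as functions on `ℝ`, but only their restrictions to `(0, T)` are used. -/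
def controls (U : Type*) [MeasurableSpace U] (T : ℝ) : Set (ℝ → U) :=
  {u | AEMeasurable u (volume.restrict (Ioo 0 T))}

/-- The Ekeland metric on controls: the Lebesgue measure of `{t ∈ (0, T) | u(t) ≠ v(t)}`. -/
def ekelandDist {U : Type*} (T : ℝ) (u v : ℝ → U) : ℝ :=
  (volume {t : ℝ | t ∈ Ioo 0 T ∧ u t ≠ v t}).toReal

/-- The metric projection `𝒫_E(x)`: the set of points of `E` nearest to `x`. -/
def metricProjSet {X : Type*} [NormedAddCommGroup X] (E : Set X) (x : X) : Set X :=
  {e | e ∈ E ∧ Metric.infDist x E = ‖x - e‖}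

/-- The closed linear span of `D - x₀`. -/
def closedSpanSub {X : Type*} [NormedAddCommGroup X] [NormedSpace ℝ X]
    (D : Set X) (x₀ : X) : Submodule ℝ X :=
  (Submodule.span ℝ ((fun d => d - x₀) '' D)).topologicalClosure

/-- A subset `D` of `X` is finite codimensional if for some `x₀` in its closed convex hull the
closed span of `D - x₀` is a finite codimensional subspace, and the closed convex hull of
`D - x₀` has an interior point relative to that subspace. -/
def IsFiniteCodimensional {X : Type*} [NormedAddCommGroup X] [NormedSpace ℝ X]
    (D : Set X) : Prop :=
  ∃ x₀ ∈ closure (convexHull ℝ D),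
    FiniteDimensional ℝ (X ⧸ closedSpanSub D x₀) ∧
    (interior {p : closedSpanSub D x₀ |
      (p : X) ∈ closure (convexHull ℝ ((fun d => d - x₀) '' D))}).Nonempty

/-- The standing hypothesis on the drift `F : [0, T] × X × U → X` and the running cost
`g : [0, T] × X × U → ℝ`: strongly measurable in `t`, continuously Fréchet differentiable in the
state, with `F`, `F_y`, `g`, `g_y` continuous in (state, control), and a uniform bound. -/
structure HypA1 {X U : Type*} [NormedAddCommGroup X] [NormedSpace ℝ X] [TopologicalSpace U]
    (T : ℝ) (F : ℝ → X → U → X) (g : ℝ → X → U → ℝ) : Prop where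
  measurable_F : ∀ y u, AEStronglyMeasurable (fun t => F t y u) (volume.restrict (Ioo 0 T))
  measurable_g : ∀ y u, AEStronglyMeasurable (fun t => g t y u) (volume.restrict (Ioo 0 T))
  differentiable_F : ∀ t ∈ Icc 0 T, ∀ u, ContDiff ℝ 1 (fun y => F t y u)
  differentiable_g : ∀ t ∈ Icc 0 T, ∀ u, ContDiff ℝ 1 (fun y => g t y u)
  continuous_F : ∀ t ∈ Icc 0 T, Continuous (fun p : X × U => F t p.1 p.2)
  continuous_g : ∀ t ∈ Icc 0 T, Continuous (fun p : X × U => g t p.1 p.2)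
  continuous_Fy : ∀ t ∈ Icc 0 T,
    Continuous (fun p : X × U => fderiv ℝ (fun y => F t y p.2) p.1)
  continuous_gy : ∀ t ∈ Icc 0 T,
    Continuous (fun p : X × U => fderiv ℝ (fun y => g t y p.2) p.1)
  bound : ∃ L : ℝ, 0 < L ∧ ∀ t ∈ Icc 0 T, ∀ (y : X) (u : U),
    ‖fderiv ℝ (fun x => F t x u) y‖ + ‖fderiv ℝ (fun x => g t x u) y‖
      + ‖F t 0 u‖ + |g t 0 u| ≤ L

/-- `y` is the trajectory `y(·; u)` of the control system
`y'(t) = A y(t) + F(t, y(t), u(t))`, `y(0) = y₀`. -/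
def IsTrajectory {X U : Type*} [NormedAddCommGroup X] [NormedSpace ℝ X]
    (S : C0Semigroup X) (T : ℝ) (F : ℝ → X → U → X) (y₀ : X) (u : ℝ → U) (y : ℝ → X) : Prop :=
  IsMildSolution S T (fun t x => F t x (u t)) y₀ y

/-- The cost `J(u)`, where `y = y(·; u)`. -/
def cost {X U : Type*} (T : ℝ) (g : ℝ → X → U → ℝ) (u : ℝ → U) (y : ℝ → X) : ℝ :=
  ∫ t in (0 : ℝ)..T, g t (y t) (u t)

/-- `(u, y)` is an optimal pair: `u` is a control, `y = y(·; u)` satisfies `y(T) ∈ E`, and `u`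
minimizes the cost among all controls whose trajectory ends in `E`. -/
structure IsOptimalPair {X U : Type*} [NormedAddCommGroup X] [NormedSpace ℝ X]
    [MeasurableSpace U] (S : C0Semigroup X) (T : ℝ) (F : ℝ → X → U → X) (g : ℝ → X → U → ℝ)
    (y₀ : X) (E : Set X) (u : ℝ → U) (y : ℝ → X) : Prop where
  control : u ∈ controls U T
  trajectory : IsTrajectory S T F y₀ u y
  endpoint : y T ∈ E
  optimal : ∀ w ∈ controls U T, ∀ x : ℝ → X, IsTrajectory S T F y₀ w x → x T ∈ E →
    cost T g u y ≤ cost T g w x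

/-- `ξ` solves the spike-variation linearization along `(u, y)` in the direction of `v`:
`ξ' = A ξ + F_y(t, y, u) ξ + F(t, y, v) - F(t, y, u)`, `ξ(0) = 0`. -/
def IsVariation {X U : Type*} [NormedAddCommGroup X] [NormedSpace ℝ X]
    (S : C0Semigroup X) (T : ℝ) (F : ℝ → X → U → X) (u : ℝ → U) (y : ℝ → X)
    (v : ℝ → U) (ξ : ℝ → X) : Prop :=
  IsMildSolution S T
    (fun t x => fderiv ℝ (fun z => F t z (u t)) (y t) x + F t (y t) (v t) - F t (y t) (u t)) 0 ξ

/-- The corresponding first order variation `ξ⁰` of the cost. -/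
def costVariation {X U : Type*} [NormedAddCommGroup X] [NormedSpace ℝ X]
    (T : ℝ) (g : ℝ → X → U → ℝ) (u : ℝ → U) (y : ℝ → X) (v : ℝ → U) (ξ : ℝ → X) : ℝ :=
  ∫ t in (0 : ℝ)..T,
    (fderiv ℝ (fun z => g t z (u t)) (y t) (ξ t) + g t (y t) (v t) - g t (y t) (u t))

/-- The set `𝒱(u)`, where `y = y(·; u)`. -/
def variationSet {X U : Type*} [NormedAddCommGroup X] [NormedSpace ℝ X] [MeasurableSpace U]
    (S : C0Semigroup X) (T : ℝ) (F : ℝ → X → U → X) (g : ℝ → X → U → ℝ)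
    (u : ℝ → U) (y : ℝ → X) : Set (ℝ × X) :=
  {p | ∃ v ∈ controls U T, ∃ ξ : ℝ → X, IsVariation S T F u y v ξ ∧
    p = (1 / T) • (costVariation T g u y v ξ, ξ T)}

/-- The set `𝓜₁`: the projection of `𝒱(u)` to the state space. -/
def reachableSet {X U : Type*} [NormedAddCommGroup X] [NormedSpace ℝ X] [MeasurableSpace U]
    (S : C0Semigroup X) (T : ℝ) (F : ℝ → X → U → X) (g : ℝ → X → U → ℝ)
    (u : ℝ → U) (y : ℝ → X) : Set X :=
  Prod.snd '' variationSet S T F g u y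

end

/-! The running cost is adjoined as an additional state, so that a control `u` has the end point
`(J(u), y(T; u))` in `ℝ × X`, and optimality becomes a statement about this point and the closed
convex set `K = (-∞, 0] × E`. Subtract `(J(ū) - η², 0)` from the end point. The distance to `K` is
then positive for every control, since otherwise some admissible control would cost at most `J(ū) -
η²`, while at `ū` it is at most `η²`. Ekeland's principle on the complete space of controls
(`DriftHyp.exists_penalized_control`) gives `u_k` within `η_k = 2^(-k)` of `ū` at which the distance
cannot decrease with slope more than `η_k`.

This is tested along spike variations: `u_k` is replaced by `v` on a set of measure about `T/N`,
spread so finely that `N` times the indicator acts like `1` (`tendsto_integral_comb`,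
`C0Semigroup.exists_spike_set`). The end point then moves by `ξ(T)/N` to first order
(`DriftHyp.exists_spike_sequence`), whence the unit normal `ζ_k` from the projection on `K` to the
shifted end point satisfies `⟨ζ_k, ξ(T)⟩ ≥ -2Tη_k` for every variation `ξ` at `u_k`. As the `η_k`
are summable, variations at `u_k` may be replaced by those at `ū` with an error that tends to zero
uniformly in `v` (`DriftHyp.eventually_variation_sub_le`).

A weak limit of the `ζ_k` along an ultrafilter is the multiplier, and both inequalities pass to the
limit. A weak limit of unit vectors could vanish; finite codimensionality excludes this. If the
limit were zero, the `X`-components of `ζ_k` would be weakly null and asymptotically nonnegative on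
`𝓜₁ - E`, hence strongly null by `IsFiniteCodimensional.tendsto_norm_zero`; since the scalar
components also tend to zero, this contradicts `‖ζ_k‖ = 1`. For (ii), `y_k(T) - 𝒫_E(y_k(T))` is a
positive multiple of the `X`-component of `ζ_k`, whose inner product with its weak limit `ẑ` is
positive along a subsequence when `ẑ ≠ 0`. -/

/-! ### Measurability of Carathéodory compositions and an integral Gronwall inequality. -/

theorem aestronglyMeasurable_of_caratheodory {Z Y : Type*} [TopologicalSpace Z]
    [TopologicalSpace Y] [TopologicalSpace.PseudoMetrizableSpace Y] {μ : Measure ℝ}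
    {G : ℝ → Z → Y} (hm : ∀ z, AEStronglyMeasurable (fun t => G t z) μ)
    (hc : ∀ᵐ t ∂μ, Continuous (G t)) {p : ℝ → Z} (hp : AEStronglyMeasurable p μ) :
    AEStronglyMeasurable (fun t => G t (p t)) μ := by
  obtain ⟨q, hq, hpq⟩ := hp
  have key : AEStronglyMeasurable (fun t => G t (q t)) μ := by
    -- Along a simple function the composition is measurable piece by piece; continuity in the
    -- second variable carries this to the limit.
    refine aestronglyMeasurable_of_tendsto_ae atTop (f := fun n t => G t (hq.approx n t)) ?_ ?_
    · intro n
      have hfin := (hq.approx n).finite_range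
      have hU : (⋃ z : range (hq.approx n), (hq.approx n) ⁻¹' {z.1}) = univ := by
        ext t; simp
      have : Countable (range (hq.approx n)) := hfin.countable.to_subtype
      rw [← Measure.restrict_univ (μ := μ), ← hU, aestronglyMeasurable_iUnion_iff]
      intro z
      refine (((hm z.1).restrict (s := (hq.approx n) ⁻¹' {z.1}))).congr ?_
      filter_upwards [ae_restrict_mem ((hq.approx n).measurableSet_fiber z.1)] with t ht
      have : hq.approx n t = z.1 := ht
      rw [this]
    · filter_upwards [hc] with t ht
      exact (ht.tendsto (q t)).comp (hq.tendsto_approx t)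
  refine key.congr ?_
  filter_upwards [hpq] with t ht
  rw [ht]

/-- Integrating the hypothesis once replaces the variable term `a` by the constant `A = ∫ a`, so
that the differential Gronwall inequality with constant coefficients applies to the second primitive
`G` of `η`. The result involves `a` only at time `t` and in the mean. -/
theorem gronwall_integral {η a : ℝ → ℝ} {K T : ℝ} (hT : 0 ≤ T) (hK : 0 < K) (hη : Continuous η)
    (ha : Continuous a) (h0 : ∀ t ∈ Icc 0 T, 0 ≤ a t)
    (h : ∀ t ∈ Icc 0 T, η t ≤ a t + K * ∫ s in (0 : ℝ)..t, η s) :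
    ∀ t ∈ Icc 0 T, η t ≤ a t + K * Real.exp (K * T) * ∫ s in (0 : ℝ)..T, a s := by
  set H : ℝ → ℝ := fun t => ∫ s in (0 : ℝ)..t, η s with hH
  have hHd : ∀ t, HasDerivAt H (η t) t := fun t => (hη.integral_hasStrictDerivAt 0 t).hasDerivAt
  have hHc : Continuous H := continuous_iff_continuousAt.2 fun t => (hHd t).continuousAt
  set A := ∫ s in (0 : ℝ)..T, a s with hA
  have hA0 : 0 ≤ A := intervalIntegral.integral_nonneg hT h0
  set G : ℝ → ℝ := fun t => ∫ s in (0 : ℝ)..t, H s with hG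
  have hGd : ∀ t, HasDerivAt G (H t) t := fun t => (hHc.integral_hasStrictDerivAt 0 t).hasDerivAt
  have hHle : ∀ t ∈ Icc 0 T, H t ≤ K * G t + A := by
    intro t ht
    have h1 : H t ≤ ∫ s in (0 : ℝ)..t, (a s + K * H s) := by
      refine intervalIntegral.integral_mono_on ht.1 (hη.intervalIntegrable _ _)
        ((ha.add (hHc.const_mul K)).intervalIntegrable _ _) fun s hs => h s ⟨hs.1, hs.2.trans ht.2⟩
    rw [intervalIntegral.integral_add (ha.intervalIntegrable _ _)
      ((hHc.const_mul K).intervalIntegrable _ _), intervalIntegral.integral_const_mul] at h1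
    have h2 : ∫ s in (0 : ℝ)..t, a s ≤ A := by
      rw [hA, ← intervalIntegral.integral_add_adjacent_intervals (ha.intervalIntegrable 0 t)
        (ha.intervalIntegrable t T)]
      have := intervalIntegral.integral_nonneg (μ := volume) ht.2
        (fun s hs => h0 s ⟨ht.1.trans hs.1, hs.2⟩)
      linarith
    change H t ≤ K * (∫ s in (0 : ℝ)..t, H s) + A
    linarith
  have hGle := le_gronwallBound_of_liminf_deriv_right_le (f := G) (f' := H) (δ := 0) (K := K)
    (ε := A) (a := 0) (b := T) (continuous_iff_continuousAt.2 fun t =>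
      (hGd t).continuousAt).continuousOn
    (fun t _ r hr => (hGd t).hasDerivWithinAt.liminf_right_slope_le hr) (by simp [hG])
    (fun t ht => hHle t ⟨ht.1, ht.2.le⟩)
  intro t ht
  have hle := hGle t ht
  rw [gronwallBound_of_K_ne_0 hK.ne'] at hle
  have hexp : Real.exp (K * (t - 0)) ≤ Real.exp (K * T) := by
    apply Real.exp_le_exp.2
    have := ht.2
    nlinarith
  have h3 : K * G t ≤ A * (Real.exp (K * T) - 1) := by
    have : K * G t ≤ A * (Real.exp (K * (t - 0)) - 1) := by
      calc K * G t ≤ K * (0 * Real.exp (K * (t - 0)) + A / K * (Real.exp (K * (t - 0)) - 1)) :=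
            mul_le_mul_of_nonneg_left hle hK.le
        _ = _ := by field_simp; ring
    nlinarith
  have h4 := hHle t ht
  have h5 := h t ht
  have h6 : K * H t ≤ K * (A * Real.exp (K * T)) := by
    apply mul_le_mul_of_nonneg_left _ hK.le; linarith
  change η t ≤ a t + K * H t at h5
  linarith

/-! ### Bounds, strong continuity and convolutions for `C₀`-semigroups. -/

namespace C0Semigroup

variable {X : Type*} [NormedAddCommGroup X] [NormedSpace ℝ X]

theorem tendsto_zero_right (S : C0Semigroup X) (x : X) :
    Tendsto (fun t => S.toFun t x) (𝓝[≥] 0) (𝓝 x) := by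
  have h : ContinuousWithinAt (fun t => S.toFun t x) (Ioi 0) 0 := by
    have := S.tendsto_zero x
    simpa [ContinuousWithinAt, S.map_zero] using this
  have := continuousWithinAt_Ioi_iff_Ici.1 h
  simpa [ContinuousWithinAt, S.map_zero] using this

/-- Uniform boundedness: otherwise the norms would be unbounded along some `t n → 0`, although every
orbit converges along it. -/
theorem exists_bound_near_zero [CompleteSpace X] (S : C0Semigroup X) :
    ∃ δ > 0, ∃ M : ℝ, ∀ t ∈ Icc 0 δ, ‖S.toFun t‖ ≤ M := by
  by_contra! hcon
  have h : ∀ n : ℕ, ∃ t ∈ Icc (0 : ℝ) (1 / ((n : ℝ) + 1)), (n : ℝ) < ‖S.toFun t‖ :=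
    fun n => hcon _ (by positivity) n
  choose t ht hlt using h
  have ht0 : Tendsto t atTop (𝓝[≥] 0) := by
    refine tendsto_nhdsWithin_iff.2 ⟨?_, Eventually.of_forall fun n => (ht n).1⟩
    exact squeeze_zero (fun n => (ht n).1) (fun n => (ht n).2)
      tendsto_one_div_add_atTop_nhds_zero_nat
  obtain ⟨C, hC⟩ := banach_steinhaus (g := fun n => S.toFun (t n)) fun x => by
    obtain ⟨C, hC⟩ := ((S.tendsto_zero_right x).comp ht0).norm.bddAbove_range
    exact ⟨C, fun n => hC ⟨n, rfl⟩⟩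
  obtain ⟨n, hn⟩ := exists_nat_gt C
  exact absurd (hC n) (not_le.2 (hn.trans (hlt n)))

theorem exists_bound [CompleteSpace X] (S : C0Semigroup X) (T : ℝ) :
    ∃ M : ℝ, 1 ≤ M ∧ ∀ t ∈ Icc 0 T, ‖S.toFun t‖ ≤ M := by
  obtain ⟨δ, hδ, M, hM⟩ := S.exists_bound_near_zero
  set M₁ := max M 1
  have hM₁ : 1 ≤ M₁ := le_max_right _ _
  have key : ∀ n : ℕ, ∀ t ∈ Icc (0 : ℝ) (n * δ), ‖S.toFun t‖ ≤ M₁ ^ (n + 1) := by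
    intro n
    induction n with
    | zero =>
      intro t ht
      simp only [Nat.cast_zero, zero_mul, zero_add, pow_one] at ht ⊢
      exact (hM t ⟨ht.1, ht.2.trans hδ.le⟩).trans (le_max_left _ _)
    | succ n ih =>
      intro t ht
      rcases le_or_gt t δ with h | h
      · exact ((hM t ⟨ht.1, h⟩).trans (le_max_left _ _)).trans
          (le_self_pow₀ hM₁ (by omega))
      · have e : S.toFun t = (S.toFun δ).comp (S.toFun (t - δ)) := by
          rw [← S.map_add δ (t - δ) hδ.le (by linarith)]; ring_nf
        have h2 := ih (t - δ) ⟨by linarith, by have := ht.2; push_cast at this; linarith⟩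
        rw [e, pow_succ' M₁ (n + 1)]
        exact (ContinuousLinearMap.opNorm_comp_le _ _).trans
          (mul_le_mul ((hM δ ⟨hδ.le, le_rfl⟩).trans (le_max_left _ _)) h2 (norm_nonneg _)
            (by linarith))
  obtain ⟨n, hn⟩ := exists_nat_gt (T / δ)
  refine ⟨M₁ ^ (n + 1), one_le_pow₀ hM₁, fun t ht => key n t ⟨ht.1, ht.2.trans ?_⟩⟩
  exact ((div_lt_iff₀ hδ).1 hn).le

/-- Clamping the time at `0` yields a function on all of `ℝ` that avoids the meaningless values at
negative times. Continuity from both sides follows from `S(t)x - S(s)x = S(s)(S(t - s)x - x)` with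
`s` the smaller time. -/
theorem continuous_max [CompleteSpace X] (S : C0Semigroup X) (x : X) :
    Continuous fun t => S.toFun (max t 0) x := by
  rw [continuous_iff_continuousAt]
  intro t₀
  obtain ⟨M, hM1, hM⟩ := S.exists_bound (max t₀ 0 + 1)
  have key : ∀ s t : ℝ, 0 ≤ s → s ≤ t → t ≤ max t₀ 0 + 1 →
      ‖S.toFun t x - S.toFun s x‖ ≤ M * ‖S.toFun (t - s) x - x‖ := by
    intro s t hs hst ht
    have e : S.toFun t = (S.toFun s).comp (S.toFun (t - s)) := by
      rw [← S.map_add s (t - s) hs (by linarith)]; ring_nf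
    rw [e, ContinuousLinearMap.comp_apply, ← map_sub]
    exact (S.toFun s).le_of_opNorm_le (hM s ⟨hs, hst.trans ht⟩) _
  have h1 : Tendsto (fun t => |max t 0 - max t₀ 0|) (𝓝 t₀) (𝓝[≥] 0) := by
    refine tendsto_nhdsWithin_iff.2 ⟨?_, Eventually.of_forall fun n => mem_Ici.2 (abs_nonneg _)⟩
    have : Continuous fun t : ℝ => |max t 0 - max t₀ 0| := by fun_prop
    simpa using this.tendsto t₀
  have h2 : Tendsto (fun t => M * ‖S.toFun |max t 0 - max t₀ 0| x - x‖) (𝓝 t₀) (𝓝 0) := by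
    have := (((S.tendsto_zero_right x).comp h1).sub_const x).norm.const_mul M
    simpa using this
  have h3 : ∀ᶠ t in 𝓝 t₀, max t 0 ≤ max t₀ 0 + 1 := by
    filter_upwards [Iio_mem_nhds (lt_add_one t₀)] with t ht
    have : t < t₀ + 1 := ht
    exact max_le (by linarith [le_max_left t₀ 0]) (by linarith [le_max_right t₀ 0])
  rw [ContinuousAt, tendsto_iff_norm_sub_tendsto_zero]
  refine squeeze_zero' (Eventually.of_forall fun _ => norm_nonneg _) ?_ h2
  filter_upwards [h3] with t ht
  rcases le_total (max t 0) (max t₀ 0) with h | h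
  · rw [norm_sub_rev, abs_sub_comm, abs_of_nonneg (sub_nonneg.2 h)]
    exact key _ _ (le_max_right _ _) h (by linarith)
  · rw [abs_of_nonneg (sub_nonneg.2 h)]
    exact key _ _ (le_max_right _ _) h ht

/-- The semigroup is only strongly continuous, so measurability in operator norm is not available;
the Carathéodory lemma needs measurability at each fixed vector only. -/
theorem aestronglyMeasurable_comp [CompleteSpace X] (S : C0Semigroup X) {μ : Measure ℝ}
    {f : ℝ → X} (hf : AEStronglyMeasurable f μ) (t : ℝ) :
    AEStronglyMeasurable (fun s => S.toFun (max (t - s) 0) (f s)) μ := by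
  refine aestronglyMeasurable_of_caratheodory (G := fun s x => S.toFun (max (t - s) 0) x)
    (fun x => ?_) (Eventually.of_forall fun s => (S.toFun _).continuous) hf
  have : Continuous fun s => S.toFun (max (t - s) 0) x :=
    (S.continuous_max x).comp (continuous_const.sub continuous_id)
  exact this.aestronglyMeasurable

theorem intervalIntegrable_conv [CompleteSpace X] (S : C0Semigroup X) {T t : ℝ} {f : ℝ → X}
    (hf : IntegrableOn f (Ioo 0 T)) (ht : t ∈ Icc 0 T) :
    IntervalIntegrable (fun s => S.toFun (t - s) (f s)) volume 0 t := by
  obtain ⟨M, hM1, hM⟩ := S.exists_bound T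
  rw [intervalIntegrable_iff_integrableOn_Ioo_of_le ht.1]
  have hf' : IntegrableOn f (Ioo 0 t) := hf.mono_set (Ioo_subset_Ioo_right ht.2)
  refine Integrable.mono' (hf'.norm.const_mul M) ?_ ?_
  · refine (S.aestronglyMeasurable_comp hf'.aestronglyMeasurable t).congr ?_
    filter_upwards [ae_restrict_mem measurableSet_Ioo] with s hs
    rw [max_eq_left (by linarith [hs.2])]
  · filter_upwards [ae_restrict_mem measurableSet_Ioo] with s hs
    exact (S.toFun _).le_of_opNorm_le (hM _ ⟨by linarith [hs.2], by linarith [hs.1, ht.2]⟩) _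

theorem norm_conv_le (S : C0Semigroup X) {T t M : ℝ}
    (hM : ∀ t ∈ Icc 0 T, ‖S.toFun t‖ ≤ M) {f : ℝ → X} {b : ℝ → ℝ}
    (hb : IntegrableOn b (Ioo 0 T)) (hfb : ∀ᵐ s ∂(volume.restrict (Ioo 0 T)), ‖f s‖ ≤ b s)
    (ht : t ∈ Icc 0 T) :
    ‖∫ s in (0 : ℝ)..t, S.toFun (t - s) (f s)‖ ≤ M * ∫ s in (0 : ℝ)..t, b s := by
  have hM0 : 0 ≤ M := (norm_nonneg _).trans (hM t ht)
  rw [← intervalIntegral.integral_const_mul]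
  refine intervalIntegral.norm_integral_le_of_norm_le ht.1 ?_ ?_
  · have := hfb
    rw [ae_restrict_iff' measurableSet_Ioo] at this
    have hne : ∀ᵐ s : ℝ, s ≠ T := by
      rw [ae_iff]; simp
    filter_upwards [this, hne] with s hs hsT hst
    have hs' := hs ⟨hst.1, lt_of_le_of_ne (hst.2.trans ht.2) hsT⟩
    exact ((S.toFun _).le_of_opNorm_le
      (hM _ ⟨by linarith [hst.2], by linarith [hst.1, ht.2]⟩) _).trans
      (mul_le_mul_of_nonneg_left hs' hM0)
  · exact ((intervalIntegrable_iff_integrableOn_Ioo_of_le ht.1).2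
      (hb.mono_set (Ioo_subset_Ioo_right ht.2))).const_mul M

theorem continuousOn_conv [CompleteSpace X] (S : C0Semigroup X) {T : ℝ} {f : ℝ → X}
    (hf : IntegrableOn f (Ioo 0 T)) :
    ContinuousOn (fun t => ∫ s in (0 : ℝ)..t, S.toFun (t - s) (f s)) (Icc 0 T) := by
  obtain ⟨M, hM1, hM⟩ := S.exists_bound T
  -- With an indicator the domain no longer depends on `t`, and dominated convergence applies: the
  -- integrand is continuous in `t` at `t₀` for every `s ≠ t₀`.
  have e : ∀ t ∈ Icc 0 T, ∫ s in (0 : ℝ)..t, S.toFun (t - s) (f s)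
      = ∫ s in Ioo 0 T, (Iio t).indicator (fun s => S.toFun (max (t - s) 0) (f s)) s := by
    intro t ht
    rw [intervalIntegral.integral_of_le ht.1, integral_Ioc_eq_integral_Ioo,
      setIntegral_indicator measurableSet_Iio]
    have : Ioo 0 T ∩ Iio t = Ioo 0 t := by
      ext s; simp only [mem_inter_iff, mem_Ioo, mem_Iio]
      exact ⟨fun h => ⟨h.1.1, h.2⟩, fun h => ⟨⟨h.1, h.2.trans_le ht.2⟩, h.2⟩⟩
    rw [this]
    refine setIntegral_congr_fun measurableSet_Ioo fun s hs => ?_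
    rw [max_eq_left (by linarith [hs.2])]
  refine ContinuousOn.congr ?_ e
  intro t₀ ht₀
  refine continuousWithinAt_of_dominated (bound := fun s => M * ‖f s‖) ?_ ?_
    (hf.norm.const_mul M) ?_
  · exact Eventually.of_forall fun t =>
      (S.aestronglyMeasurable_comp hf.aestronglyMeasurable t).indicator measurableSet_Iio
  · filter_upwards [self_mem_nhdsWithin] with t ht
    filter_upwards [ae_restrict_mem measurableSet_Ioo] with s hs
    by_cases hst : s < t
    · rw [indicator_of_mem (by exact hst), max_eq_left (by linarith)]
      exact (S.toFun _).le_of_opNorm_le (hM _ ⟨by linarith, by linarith [hs.1, ht.2]⟩) _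
    · rw [indicator_of_notMem (by exact hst), norm_zero]; positivity
  · have hne : ∀ᵐ s ∂(volume.restrict (Ioo 0 T)), s ≠ t₀ :=
      ae_restrict_of_ae (by rw [ae_iff]; simp)
    filter_upwards [hne] with s hs
    apply ContinuousAt.continuousWithinAt
    rcases lt_or_gt_of_ne hs with h | h
    · have : (fun t => (Iio t).indicator (fun s => S.toFun (max (t - s) 0) (f s)) s)
          =ᶠ[𝓝 t₀] fun t => S.toFun (max (t - s) 0) (f s) := by
        filter_upwards [Ioi_mem_nhds h] with t ht
        exact indicator_of_mem (by exact ht) _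
      refine ContinuousAt.congr ?_ this.symm
      exact ((S.continuous_max (f s)).comp (continuous_id.sub continuous_const)).continuousAt
    · have : (fun t => (Iio t).indicator (fun s => S.toFun (max (t - s) 0) (f s)) s)
          =ᶠ[𝓝 t₀] fun t => 0 := by
        filter_upwards [Iio_mem_nhds h] with t ht
        exact indicator_of_notMem (by simpa using (le_of_lt ht)) _
      exact continuousAt_const.congr this.symm

end C0Semigroup

theorem setIntegral_Ioo_eq_intervalIntegral {Y : Type*} [NormedAddCommGroup Y] [NormedSpace ℝ Y]
    {T : ℝ} (hT : 0 ≤ T) (f : ℝ → Y) : ∫ s in Ioo 0 T, f s = ∫ s in (0 : ℝ)..T, f s := by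
  rw [intervalIntegral.integral_of_le hT, integral_Ioc_eq_integral_Ioo]

theorem intervalIntegral_le_setIntegral_Ioo {T t : ℝ} (ht : t ∈ Icc 0 T) {b : ℝ → ℝ}
    (hb : IntegrableOn b (Ioo 0 T)) (hb0 : ∀ᵐ s ∂(volume.restrict (Ioo 0 T)), 0 ≤ b s) :
    ∫ s in (0 : ℝ)..t, b s ≤ ∫ s in Ioo 0 T, b s := by
  rw [← setIntegral_Ioo_eq_intervalIntegral ht.1]
  exact setIntegral_mono_set hb hb0 (Ioo_subset_Ioo_right ht.2).eventuallyLE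

theorem integrableOn_Ioo_of_continuousOn {Y : Type*} [NormedAddCommGroup Y] {T : ℝ} {f : ℝ → Y}
    (hf : ContinuousOn f (Icc 0 T)) : IntegrableOn f (Ioo 0 T) :=
  (hf.integrableOn_compact isCompact_Icc).mono_set Ioo_subset_Icc_self

theorem integrableOn_Ioo_of_bound {Y : Type*} [NormedAddCommGroup Y] {T : ℝ} {f : ℝ → Y}
    (hf : AEStronglyMeasurable f (volume.restrict (Ioo 0 T))) {C : ℝ}
    (hC : ∀ s ∈ Ioo 0 T, ‖f s‖ ≤ C) : IntegrableOn f (Ioo 0 T) :=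
  Integrable.mono' (g := fun _ => C) (integrableOn_const (by simp)) hf
    ((ae_restrict_mem measurableSet_Ioo).mono hC)

/-! ### A priori estimate and existence for mild solutions. -/

namespace C0Semigroup

variable {X : Type*} [NormedAddCommGroup X] [NormedSpace ℝ X] [CompleteSpace X]

theorem continuousOn_orbit (S : C0Semigroup X) (x : X) (T : ℝ) :
    ContinuousOn (fun t => S.toFun t x) (Icc 0 T) :=
  (S.continuous_max x).continuousOn.congr fun t ht => by
    beta_reduce; rw [max_eq_left ht.1]

/-- The source of all stability estimates below, with `C` depending on `S`, `T` and `L` alone. The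
inhomogeneity `a` enters through `‖a t‖` and its `L¹` norm, never its supremum; this is what makes
the weak smallness of oscillating forcings sufficient. -/
theorem mild_estimate (S : C0Semigroup X) {T : ℝ} (hT : 0 ≤ T) {L : ℝ} (hL : 0 ≤ L) :
    ∃ C : ℝ, 0 ≤ C ∧ ∀ (η a f : ℝ → X) (b : ℝ → ℝ), ContinuousOn η (Icc 0 T) →
      ContinuousOn a (Icc 0 T) → IntegrableOn b (Ioo 0 T) →
      (∀ᵐ s ∂(volume.restrict (Ioo 0 T)), 0 ≤ b s) →
      (∀ᵐ s ∂(volume.restrict (Ioo 0 T)), ‖f s‖ ≤ L * ‖η s‖ + b s) →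
      (∀ t ∈ Icc 0 T, η t = a t + ∫ s in (0 : ℝ)..t, S.toFun (t - s) (f s)) →
      ∀ t ∈ Icc 0 T, ‖η t‖ ≤ ‖a t‖ + C * ((∫ s in Ioo 0 T, ‖a s‖) + ∫ s in Ioo 0 T, b s) := by
  obtain ⟨M, hM1, hM⟩ := S.exists_bound T
  set K := M * (L + 1) with hK
  have hK0 : 0 < K := by positivity
  refine ⟨M + K * Real.exp (K * T) * (1 + T * M), by positivity, ?_⟩
  intro η a f b hη ha hb hb0 hf heq
  set B := ∫ s in Ioo 0 T, b s with hB
  have hB0 : 0 ≤ B := integral_nonneg_of_ae hb0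
  set η' : ℝ → ℝ := fun t => ‖η (projIcc 0 T hT t)‖ with hη'
  set a' : ℝ → ℝ := fun t => ‖a (projIcc 0 T hT t)‖ + M * B with ha'
  have hη'c : Continuous η' :=
    ((continuousOn_iff_continuous_domRestrict.1 hη).comp continuous_projIcc).norm
  have ha'c : Continuous a' :=
    ((continuousOn_iff_continuous_domRestrict.1 ha).comp continuous_projIcc).norm.add
      continuous_const
  have hηe : ∀ t ∈ Icc 0 T, η' t = ‖η t‖ := fun t ht => by simp [hη', projIcc_of_mem hT ht]
  have hae : ∀ t ∈ Icc 0 T, a' t = ‖a t‖ + M * B := fun t ht => by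
    simp [ha', projIcc_of_mem hT ht]
  have hηi : IntegrableOn (fun s => ‖η s‖) (Ioo 0 T) := integrableOn_Ioo_of_continuousOn hη.norm
  have key := gronwall_integral hT hK0 hη'c ha'c (fun t _ => by positivity) (fun t ht => by
    rw [hηe t ht, hae t ht, heq t ht]
    have h1 := S.norm_conv_le hM ((hηi.const_mul L).add hb) hf ht
    have h2 : ∫ s in (0 : ℝ)..t, η' s = ∫ s in (0 : ℝ)..t, ‖η s‖ := by
      refine intervalIntegral.integral_congr fun s hs => ?_
      rw [uIcc_of_le ht.1] at hs
      exact hηe s ⟨hs.1, hs.2.trans ht.2⟩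
    have hii : ∀ c : ℝ → ℝ, IntegrableOn c (Ioo 0 T) → IntervalIntegrable c volume 0 t :=
      fun c hc => (intervalIntegrable_iff_integrableOn_Ioo_of_le ht.1).2
        (hc.mono_set (Ioo_subset_Ioo_right ht.2))
    have h3 : (∫ s in (0 : ℝ)..t, ((fun s => L * ‖η s‖) + b) s)
        = L * (∫ s in (0 : ℝ)..t, ‖η s‖) + ∫ s in (0 : ℝ)..t, b s := by
      simp only [Pi.add_apply]
      rw [intervalIntegral.integral_add ((hii _ hηi).const_mul L) (hii _ hb),
        intervalIntegral.integral_const_mul]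
    have h4 : ∫ s in (0 : ℝ)..t, b s ≤ B := intervalIntegral_le_setIntegral_Ioo ht hb hb0
    have h5 : 0 ≤ ∫ s in (0 : ℝ)..t, ‖η s‖ :=
      intervalIntegral.integral_nonneg ht.1 fun _ _ => norm_nonneg _
    rw [h2]
    refine (norm_add_le _ _).trans ?_
    have h6 : M * (L * (∫ s in (0 : ℝ)..t, ‖η s‖) + ∫ s in (0 : ℝ)..t, b s)
        ≤ M * (L * (∫ s in (0 : ℝ)..t, ‖η s‖) + B) := by gcongr
    rw [← h3] at h6
    have h7 : 0 ≤ M * ∫ s in (0 : ℝ)..t, ‖η s‖ := by positivity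
    have h8 := h1.trans h6
    rw [hK]
    linarith)
  intro t ht
  have h1 := key t ht
  rw [hηe t ht, hae t ht] at h1
  have h2 : ∫ s in (0 : ℝ)..T, a' s = (∫ s in Ioo 0 T, ‖a s‖) + T * (M * B) := by
    have hc := intervalIntegral.integral_congr (μ := volume) (a := 0) (b := T) (f := a')
      (g := fun s => ‖a s‖ + M * B) (fun s hs => by
        rw [uIcc_of_le hT] at hs; exact hae s hs)
    rw [hc, intervalIntegral.integral_add, intervalIntegral.integral_const,
      setIntegral_Ioo_eq_intervalIntegral hT]
    · simp
    · exact (intervalIntegrable_iff_integrableOn_Ioo_of_le hT).2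
        (integrableOn_Ioo_of_continuousOn ha.norm)
    · exact intervalIntegrable_const
  rw [h2] at h1
  have h3 : 0 ≤ ∫ s in Ioo 0 T, ‖a s‖ := integral_nonneg fun _ => norm_nonneg _
  refine h1.trans ?_
  have h4 : 0 ≤ M * ∫ s in Ioo 0 T, ‖a s‖ := by positivity
  have h5 : 0 ≤ K * Real.exp (K * T) * B := by positivity
  have h6 : 0 ≤ K * Real.exp (K * T) * (T * M) * ∫ s in Ioo 0 T, ‖a s‖ := by positivity
  nlinarith

theorem exists_isMildSolution (S : C0Semigroup X) {T : ℝ} (hT : 0 ≤ T) {L C : ℝ} (hL : 0 ≤ L)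
    {φ : ℝ → X → X}
    (hm : ∀ y : ℝ → X, Continuous y →
      AEStronglyMeasurable (fun s => φ s (y s)) (volume.restrict (Ioo 0 T)))
    (hlip : ∀ s ∈ Ioo 0 T, ∀ x x', ‖φ s x - φ s x'‖ ≤ L * ‖x - x'‖)
    (hbd : ∀ s ∈ Ioo 0 T, ‖φ s 0‖ ≤ C) (x₀ : X) :
    ∃ y, IsMildSolution S T φ x₀ y := by
  obtain ⟨M, hM1, hM⟩ := S.exists_bound T
  -- Banach's fixed point theorem for the unknown multiplied by `e^(-lt)`: the weight turns the
  -- Lipschitz constant into `M L / l ≤ 1/2`, on the whole interval at once. The `+ 1` keeps `l`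
  -- positive when `L = 0`.
  set l := 2 * M * (L + 1) with hl
  have hl0 : 0 < l := by positivity
  let E : C(Icc (0 : ℝ) T, X) → ℝ → X := fun w s => Real.exp (l * s) • w (projIcc 0 T hT s)
  have hE : ∀ w, Continuous (E w) := fun w =>
    (by fun_prop : Continuous fun s => Real.exp (l * s)).smul
      (w.continuous.comp continuous_projIcc)
  have hint : ∀ y : ℝ → X, Continuous y → IntegrableOn (fun s => φ s (y s)) (Ioo 0 T) := by
    intro y hy
    refine Integrable.mono' (g := fun s => L * ‖y s‖ + C)
      (((integrableOn_Ioo_of_continuousOn hy.continuousOn.norm).const_mul L).add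
      (integrableOn_const (by simp))) (hm y hy) ?_
    filter_upwards [ae_restrict_mem measurableSet_Ioo] with s hs
    have h1 := hlip s hs (y s) 0
    rw [sub_zero] at h1
    calc ‖φ s (y s)‖ = ‖(φ s (y s) - φ s 0) + φ s 0‖ := by rw [sub_add_cancel]
      _ ≤ _ := (norm_add_le _ _).trans (add_le_add h1 (hbd s hs))
  let G : C(Icc (0 : ℝ) T, X) → ℝ → X := fun w t => S.toFun t x₀ +
    ∫ s in (0 : ℝ)..t, S.toFun (t - s) (φ s (E w s))
  have hG : ∀ w, ContinuousOn (G w) (Icc 0 T) := fun w =>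
    (S.continuousOn_orbit x₀ T).add (S.continuousOn_conv (hint _ (hE w)))
  let Φ : C(Icc (0 : ℝ) T, X) → C(Icc (0 : ℝ) T, X) := fun w =>
    ⟨fun t => Real.exp (-(l * t)) • G w t,
      (by fun_prop : Continuous fun t : Icc (0 : ℝ) T => Real.exp (-(l * (t : ℝ)))).smul
        (continuousOn_iff_continuous_domRestrict.1 (hG w))⟩
  have hΦ : ContractingWith (1 / 2) Φ := by
    refine ⟨by rw [← NNReal.coe_lt_coe]; norm_num, LipschitzWith.of_dist_le_mul fun w w' => ?_⟩
    rw [ContinuousMap.dist_le (by positivity)]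
    rintro ⟨t, ht⟩
    have ht1 := ht.1
    change dist (Real.exp (-(l * t)) • G w t) (Real.exp (-(l * t)) • G w' t) ≤ _
    rw [dist_eq_norm, ← smul_sub, norm_smul, Real.norm_eq_abs, abs_of_pos (Real.exp_pos _)]
    have e : G w t - G w' t
        = ∫ s in (0 : ℝ)..t, S.toFun (t - s) (φ s (E w s) - φ s (E w' s)) := by
      simp only [G, map_sub]
      rw [intervalIntegral.integral_sub (S.intervalIntegrable_conv (hint _ (hE w)) ht)
        (S.intervalIntegrable_conv (hint _ (hE w')) ht)]
      abel
    have hb : IntegrableOn (fun s => L * dist w w' * Real.exp (l * s)) (Ioo 0 T) :=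
      integrableOn_Ioo_of_continuousOn (by fun_prop)
    have h1 := S.norm_conv_le hM (f := fun s => φ s (E w s) - φ s (E w' s)) hb (by
      filter_upwards [ae_restrict_mem measurableSet_Ioo] with s hs
      refine (hlip s hs _ _).trans ?_
      rw [mul_assoc]
      refine mul_le_mul_of_nonneg_left ?_ hL
      simp only [E]
      rw [← smul_sub, norm_smul, Real.norm_eq_abs, abs_of_pos (Real.exp_pos _), mul_comm,
        ← dist_eq_norm]
      exact mul_le_mul_of_nonneg_right (ContinuousMap.dist_apply_le_dist _) (Real.exp_pos _).le)
      ht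
    rw [intervalIntegral.integral_const_mul] at h1
    have h2 : ∫ s in (0 : ℝ)..t, Real.exp (l * s) = (Real.exp (l * t) - 1) / l := by
      rw [intervalIntegral.integral_comp_mul_left (fun x => Real.exp x) hl0.ne', integral_exp]
      simp [div_eq_inv_mul]
    rw [h2, ← e] at h1
    have hd : 0 ≤ dist w w' := dist_nonneg
    calc Real.exp (-(l * t)) * ‖G w t - G w' t‖
        ≤ Real.exp (-(l * t)) * (M * (L * dist w w' * ((Real.exp (l * t) - 1) / l))) := by
          gcongr
      _ = (M * L / l) * dist w w' * (1 - Real.exp (-(l * t))) := by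
          have : Real.exp (-(l * t)) * Real.exp (l * t) = 1 := by
            rw [← Real.exp_add]; simp
          field_simp
          linear_combination L * dist w w' * this
      _ ≤ (M * L / l) * dist w w' * 1 := by
          gcongr
          linarith [Real.exp_pos (-(l * t))]
      _ ≤ (1 / 2) * dist w w' := by
          rw [mul_one]
          refine mul_le_mul_of_nonneg_right ?_ hd
          rw [div_le_div_iff₀ hl0 two_pos, hl]
          nlinarith
      _ = _ := by norm_num
  set w := ContractingWith.fixedPoint Φ hΦ
  have hw : Φ w = w := hΦ.fixedPoint_isFixedPt
  refine ⟨E w, (hE w).continuousOn, hint _ (hE w), fun t ht => ?_⟩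
  have h1 : w ⟨t, ht⟩ = Real.exp (-(l * t)) • G w t := by
    conv_lhs => rw [← hw]
    rfl
  change Real.exp (l * t) • w (projIcc 0 T hT t) = G w t
  rw [projIcc_of_mem hT ht, h1, smul_smul, ← Real.exp_add]
  simp

end C0Semigroup

/-! ### Trajectories and variations, for drifts general enough to cover both `F` and the pair `(g,
F)`. -/

/-- A drift `F` on `[0, T]` that is measurable in time, `C¹` in the state, continuous together
with its derivative in (state, control), with `‖F_y‖ ≤ L` and `‖F(·, 0, ·)‖ ≤ L`. -/
structure DriftHyp {X U : Type*} [NormedAddCommGroup X] [NormedSpace ℝ X] [TopologicalSpace U]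
    (T L : ℝ) (F : ℝ → X → U → X) : Prop where
  nonneg : 0 ≤ L
  measurable : ∀ y u, AEStronglyMeasurable (fun t => F t y u) (volume.restrict (Ioo 0 T))
  contDiff : ∀ t ∈ Icc 0 T, ∀ u, ContDiff ℝ 1 (fun y => F t y u)
  continuous : ∀ t ∈ Icc 0 T, Continuous (fun p : X × U => F t p.1 p.2)
  continuous_fderiv : ∀ t ∈ Icc 0 T,
    Continuous (fun p : X × U => fderiv ℝ (fun y => F t y p.2) p.1)
  norm_fderiv_le : ∀ t ∈ Icc 0 T, ∀ y u, ‖fderiv ℝ (fun x => F t x u) y‖ ≤ L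
  norm_zero_le : ∀ t ∈ Icc 0 T, ∀ u, ‖F t 0 u‖ ≤ L

theorem IsMildSolution.sub_eq {X : Type*} [NormedAddCommGroup X] [NormedSpace ℝ X]
    [CompleteSpace X] {S : C0Semigroup X} {T : ℝ} {φ ψ : ℝ → X → X} {x₀ : X} {y z : ℝ → X}
    (hy : IsMildSolution S T φ x₀ y) (hz : IsMildSolution S T ψ x₀ z) {t : ℝ} (ht : t ∈ Icc 0 T) :
    y t - z t = ∫ s in (0 : ℝ)..t, S.toFun (t - s) (φ s (y s) - ψ s (z s)) := by
  rw [hy.2.2 t ht, hz.2.2 t ht]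
  simp only [map_sub]
  rw [intervalIntegral.integral_sub (S.intervalIntegrable_conv hy.2.1 ht)
    (S.intervalIntegrable_conv hz.2.1 ht)]
  abel

theorem ekelandDist_self {U : Type*} (T : ℝ) (u : ℝ → U) : ekelandDist T u u = 0 := by
  simp [ekelandDist]

theorem ekelandDist_nonneg {U : Type*} (T : ℝ) (u v : ℝ → U) : 0 ≤ ekelandDist T u v :=
  ENNReal.toReal_nonneg

theorem ekelandDist_comm {U : Type*} (T : ℝ) (u v : ℝ → U) :
    ekelandDist T u v = ekelandDist T v u := by
  simp only [ekelandDist, ne_comm]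

theorem volume_disagree_ne_top {U : Type*} (T : ℝ) (u v : ℝ → U) :
    volume {t : ℝ | t ∈ Ioo 0 T ∧ u t ≠ v t} ≠ ⊤ :=
  ((measure_mono fun _ h => h.1).trans_lt (by simp : volume (Ioo 0 T) < ⊤)).ne

theorem ekelandDist_triangle {U : Type*} (T : ℝ) (u v w : ℝ → U) :
    ekelandDist T u w ≤ ekelandDist T u v + ekelandDist T v w := by
  unfold ekelandDist
  rw [← ENNReal.toReal_add (volume_disagree_ne_top T u v) (volume_disagree_ne_top T v w)]
  refine ENNReal.toReal_mono (ENNReal.add_ne_top.2 ⟨volume_disagree_ne_top T u v,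
    volume_disagree_ne_top T v w⟩) ((measure_mono ?_).trans (measure_union_le _ _))
  rintro t ⟨ht, hne⟩
  by_cases h : u t = v t
  · exact Or.inr ⟨ht, h ▸ hne⟩
  · exact Or.inl ⟨ht, h⟩

namespace DriftHyp

variable {X U : Type*} [NormedAddCommGroup X] [NormedSpace ℝ X] [CompleteSpace X]
  [MetricSpace U] [TopologicalSpace.SeparableSpace U] [MeasurableSpace U] [BorelSpace U]
  {T L : ℝ} {F : ℝ → X → U → X} {u v : ℝ → U} {y ξ : ℝ → X}

omit [CompleteSpace X] [TopologicalSpace.SeparableSpace U] [MeasurableSpace U] [BorelSpace U] in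
theorem lipschitz (h : DriftHyp T L F) {t : ℝ} (ht : t ∈ Icc 0 T) (x x' : X) (u : U) :
    ‖F t x u - F t x' u‖ ≤ L * ‖x - x'‖ :=
  convex_univ.norm_image_sub_le_of_norm_fderiv_le (𝕜 := ℝ) (f := fun y => F t y u)
    (fun z _ => ((h.contDiff t ht u).differentiable one_ne_zero) z)
    (fun z _ => h.norm_fderiv_le t ht z u) (mem_univ _) (mem_univ _)

omit [CompleteSpace X] [TopologicalSpace.SeparableSpace U] [MeasurableSpace U] [BorelSpace U] in
theorem growth (h : DriftHyp T L F) {t : ℝ} (ht : t ∈ Icc 0 T) (x : X) (u : U) :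
    ‖F t x u‖ ≤ L * ‖x‖ + L := by
  have h1 := h.lipschitz ht x 0 u
  rw [sub_zero] at h1
  calc ‖F t x u‖ = ‖(F t x u - F t 0 u) + F t 0 u‖ := by rw [sub_add_cancel]
    _ ≤ _ := (norm_add_le _ _).trans (add_le_add h1 (h.norm_zero_le t ht u))

omit [CompleteSpace X] in
theorem aestronglyMeasurable_comp (h : DriftHyp T L F)
    (hy : AEStronglyMeasurable y (volume.restrict (Ioo 0 T))) (hu : u ∈ controls U T) :
    AEStronglyMeasurable (fun t => F t (y t) (u t)) (volume.restrict (Ioo 0 T)) := by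
  have : SecondCountableTopology U := UniformSpace.secondCountable_of_separable U
  have hu' : AEStronglyMeasurable u (volume.restrict (Ioo 0 T)) :=
    AEMeasurable.aestronglyMeasurable hu
  refine aestronglyMeasurable_of_caratheodory (G := fun t (p : X × U) => F t p.1 p.2)
    (fun p => h.measurable p.1 p.2) ?_ (hy.prodMk hu')
  filter_upwards [ae_restrict_mem measurableSet_Ioo] with t ht
  exact h.continuous t (Ioo_subset_Icc_self ht)

omit [CompleteSpace X] in
theorem aestronglyMeasurable_fderiv (h : DriftHyp T L F)
    (hy : AEStronglyMeasurable y (volume.restrict (Ioo 0 T))) (hu : u ∈ controls U T)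
    (hξ : AEStronglyMeasurable ξ (volume.restrict (Ioo 0 T))) :
    AEStronglyMeasurable (fun t => fderiv ℝ (fun z => F t z (u t)) (y t) (ξ t))
      (volume.restrict (Ioo 0 T)) := by
  have : SecondCountableTopology U := UniformSpace.secondCountable_of_separable U
  have hu' : AEStronglyMeasurable u (volume.restrict (Ioo 0 T)) :=
    AEMeasurable.aestronglyMeasurable hu
  refine aestronglyMeasurable_of_caratheodory
    (G := fun t (p : (X × U) × X) => fderiv ℝ (fun z => F t z p.1.2) p.1.1 p.2)
    (fun p => ?_) ?_ ((hy.prodMk hu').prodMk hξ)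
  -- At a fixed point and direction the derivative is the limit of the difference quotients with
  -- step `1 / n`, which are measurable in time.
  · refine aestronglyMeasurable_of_tendsto_ae atTop
      (f := fun (n : ℕ) t => (n : ℝ) • (F t (p.1.1 + (n : ℝ)⁻¹ • p.2) p.1.2 - F t p.1.1 p.1.2))
      (fun n => ((h.measurable _ _).sub (h.measurable _ _)).const_smul _) ?_
    filter_upwards [ae_restrict_mem measurableSet_Ioo] with t ht
    have hd : HasFDerivAt (fun z => F t z p.1.2) (fderiv ℝ (fun z => F t z p.1.2) p.1.1) p.1.1 :=
      (((h.contDiff t (Ioo_subset_Icc_self ht) p.1.2).differentiable one_ne_zero) _).hasFDerivAt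
    refine hd.lim_real p.2 |>.comp tendsto_natCast_atTop_atTop
  · filter_upwards [ae_restrict_mem measurableSet_Ioo] with t ht
    have := h.continuous_fderiv t (Ioo_subset_Icc_self ht)
    exact (this.comp continuous_fst).clm_apply continuous_snd

theorem exists_trajectory (h : DriftHyp T L F) (hT : 0 ≤ T) (S : C0Semigroup X) (y₀ : X)
    (hu : u ∈ controls U T) : ∃ y, IsTrajectory S T F y₀ u y :=
  S.exists_isMildSolution hT h.nonneg (C := L) (φ := fun t x => F t x (u t))
    (fun _ hy => h.aestronglyMeasurable_comp hy.aestronglyMeasurable hu)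
    (fun _ hs x x' => h.lipschitz (Ioo_subset_Icc_self hs) x x' _)
    (fun _ hs => h.norm_zero_le _ (Ioo_subset_Icc_self hs) _) y₀

theorem exists_variation (h : DriftHyp T L F) (hT : 0 ≤ T) (S : C0Semigroup X)
    (hu : u ∈ controls U T) (hv : v ∈ controls U T) (hy : ContinuousOn y (Icc 0 T)) :
    ∃ ξ, IsVariation S T F u y v ξ := by
  obtain ⟨R, hR⟩ := isCompact_Icc.exists_bound_of_continuousOn hy
  have hym := (integrableOn_Ioo_of_continuousOn hy).aestronglyMeasurable
  refine S.exists_isMildSolution hT h.nonneg (C := 2 * (L * R + L)) ?_ ?_ ?_ 0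
  · intro ξ hξ
    exact ((h.aestronglyMeasurable_fderiv hym hu hξ.aestronglyMeasurable).add
      (h.aestronglyMeasurable_comp hym hv)).sub (h.aestronglyMeasurable_comp hym hu)
  · intro s hs x x'
    rw [sub_sub_sub_cancel_right, add_sub_add_right_eq_sub, ← map_sub]
    exact ContinuousLinearMap.le_of_opNorm_le _
      (h.norm_fderiv_le s (Ioo_subset_Icc_self hs) _ _) _
  · intro s hs
    have hs' := Ioo_subset_Icc_self hs
    rw [map_zero, zero_add]
    have h1 := h.growth hs' (y s) (v s)
    have h2 := h.growth hs' (y s) (u s)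
    have h3 := mul_le_mul_of_nonneg_left (hR s hs') h.nonneg
    exact (norm_sub_le _ _).trans (by linarith)

omit [TopologicalSpace.SeparableSpace U] [MeasurableSpace U] [BorelSpace U] in
theorem exists_trajectory_bound (h : DriftHyp T L F) (hT : 0 ≤ T) (S : C0Semigroup X) (y₀ : X) :
    ∃ R : ℝ, 0 ≤ R ∧ ∀ (u : ℝ → U) (y : ℝ → X), IsTrajectory S T F y₀ u y →
      ∀ t ∈ Icc 0 T, ‖y t‖ ≤ R := by
  obtain ⟨C, hC0, hC⟩ := S.mild_estimate hT h.nonneg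
  obtain ⟨M, hM1, hM⟩ := S.exists_bound T
  refine ⟨M * ‖y₀‖ + C * ((∫ s in Ioo 0 T, ‖S.toFun s y₀‖) + ∫ s in Ioo 0 T, L), ?_, ?_⟩
  · have h1 : 0 ≤ ∫ s in Ioo 0 T, ‖S.toFun s y₀‖ := integral_nonneg fun _ => norm_nonneg _
    have h2 : 0 ≤ ∫ s in Ioo 0 T, L := integral_nonneg fun _ => h.nonneg
    positivity
  · intro u y hy t ht
    have := hC y (fun t => S.toFun t y₀) (fun s => F s (y s) (u s)) (fun _ => L) hy.1
      (S.continuousOn_orbit y₀ T) (integrableOn_const (by simp))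
      (Eventually.of_forall fun _ => h.nonneg) (by
        filter_upwards [ae_restrict_mem measurableSet_Ioo] with s hs
        exact h.growth (Ioo_subset_Icc_self hs) _ _) hy.2.2 t ht
    have h3 := (S.toFun t).le_of_opNorm_le (hM t ht) y₀
    linarith

omit [TopologicalSpace.SeparableSpace U] [MeasurableSpace U] [BorelSpace U] in
theorem exists_trajectory_lipschitz (h : DriftHyp T L F) (hT : 0 ≤ T) (S : C0Semigroup X)
    (y₀ : X) : ∃ C : ℝ, 0 ≤ C ∧ ∀ (u u' : ℝ → U) (y y' : ℝ → X), IsTrajectory S T F y₀ u y →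
      IsTrajectory S T F y₀ u' y' → ∀ t ∈ Icc 0 T, ‖y t - y' t‖ ≤ C * ekelandDist T u u' := by
  obtain ⟨C, hC0, hC⟩ := S.mild_estimate hT h.nonneg
  obtain ⟨R, hR0, hR⟩ := h.exists_trajectory_bound hT S y₀
  have hL := h.nonneg
  have hc : 0 ≤ 2 * (L * R + L) := by positivity
  refine ⟨C * (2 * (L * R + L)), by positivity, ?_⟩
  intro u u' y y' hy hy' t ht
  -- The forcing in the equation for the difference is supported on `D`. This set need not be
  -- measurable, so a measurable hull of the same measure replaces it.
  set D := {t : ℝ | t ∈ Ioo 0 T ∧ u t ≠ u' t} with hD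
  have hDm := measurableSet_toMeasurable volume D
  have hcb : IntegrableOn ((toMeasurable volume D).indicator fun _ => 2 * (L * R + L))
    (Ioo 0 T) := (integrableOn_const (by simp)).indicator hDm
  have := hC (fun t => y t - y' t) (fun _ => 0) (fun s => F s (y s) (u s) - F s (y' s) (u' s))
    ((toMeasurable volume D).indicator fun _ => 2 * (L * R + L)) (hy.1.sub hy'.1)
    continuousOn_const hcb (Eventually.of_forall fun s => indicator_nonneg (fun _ _ => hc) s) (by
      filter_upwards [ae_restrict_mem measurableSet_Ioo] with s hs
      have hs' := Ioo_subset_Icc_self hs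
      have h1 := h.lipschitz hs' (y s) (y' s) (u s)
      by_cases hsD : s ∈ toMeasurable volume D
      · rw [indicator_of_mem hsD]
        have e : F s (y s) (u s) - F s (y' s) (u' s) = (F s (y s) (u s) - F s (y' s) (u s))
          + (F s (y' s) (u s) - F s (y' s) (u' s)) := by abel
        have h2 := h.growth hs' (y' s) (u s)
        have h3 := h.growth hs' (y' s) (u' s)
        have h4 := mul_le_mul_of_nonneg_left (hR u' y' hy' s hs') hL
        rw [e]
        refine (norm_add_le _ _).trans (add_le_add h1 ((norm_sub_le _ _).trans ?_))
        linarith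
      · rw [indicator_of_notMem hsD, add_zero]
        have : u s = u' s := by
          by_contra hne
          exact hsD (subset_toMeasurable _ _ ⟨hs, hne⟩)
        rw [← this]
        exact h1) (fun t ht => by rw [zero_add]; exact hy.sub_eq hy' ht) t ht
  simp only [norm_zero, integral_zero, zero_add] at this
  refine this.trans ?_
  rw [mul_assoc]
  refine mul_le_mul_of_nonneg_left ?_ hC0
  rw [integral_indicator_const _ hDm, smul_eq_mul, mul_comm]
  refine mul_le_mul_of_nonneg_left ?_ hc
  refine ENNReal.toReal_mono (volume_disagree_ne_top T u u') ?_
  rw [← hD, ← measure_toMeasurable D]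
  exact Measure.restrict_apply_le _ _

omit [TopologicalSpace.SeparableSpace U] [MeasurableSpace U] [BorelSpace U] in
theorem trajectory_unique (h : DriftHyp T L F) (hT : 0 ≤ T) {S : C0Semigroup X} {y₀ : X}
    {y y' : ℝ → X} (hy : IsTrajectory S T F y₀ u y) (hy' : IsTrajectory S T F y₀ u y') {t : ℝ}
    (ht : t ∈ Icc 0 T) : y t = y' t := by
  obtain ⟨C, -, hC⟩ := h.exists_trajectory_lipschitz hT S y₀
  have := hC u u y y' hy hy' t ht
  rw [ekelandDist_self, mul_zero] at this
  exact sub_eq_zero.1 (norm_le_zero_iff.1 this)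

end DriftHyp

/-! ### Rapidly oscillating sets and spike variations. -/

theorem tendsto_integral_norm_translation_sub {Y : Type*} [NormedAddCommGroup Y]
    [NormedSpace ℝ Y] {f : ℝ → Y} (hf : Integrable f) :
    Tendsto (fun h : ℝ => ∫ t, ‖f (t + h) - f t‖) (𝓝 0) (𝓝 0) := by
  have : Fact ((1 : ENNReal) ≤ 1) := ⟨le_rfl⟩
  have hmp : ∀ h : ℝ, MeasurePreserving (fun t : ℝ => t + h) volume volume :=
    fun h => measurePreserving_add_right volume h
  let g : C(ℝ, C(ℝ, ℝ)) := (ContinuousMap.mk (fun p : ℝ × ℝ => p.2 + p.1) (by fun_prop)).curry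
  have hcont : Continuous fun h : ℝ =>
      Lp.compMeasurePreserving (g h) (hmp h) (hf.toL1 f) :=
    Continuous.compMeasurePreservingLp (μ := volume) (ν := volume) (p := 1)
      (f := fun _ : ℝ => hf.toL1 f) continuous_const g.continuous (fun h => hmp h) (by simp)
  have hi : ∀ h : ℝ, Integrable (fun t => f (t + h)) := fun h => hf.comp_add_right h
  have e : ∀ h : ℝ, Lp.compMeasurePreserving (g h) (hmp h) (hf.toL1 f)
      = (hi h).toL1 (fun t => f (t + h)) := fun h =>
    Lp.toLp_compMeasurePreserving (memLp_one_iff_integrable.2 hf) (hmp h)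
  have h0 : Tendsto (fun h : ℝ => ‖(hi h).toL1 (fun t => f (t + h)) - hf.toL1 f‖) (𝓝 0) (𝓝 0) := by
    have h1 := ((hcont.tendsto 0).sub_const (hf.toL1 f)).norm
    simp only [e] at h1
    have h2 : (hi 0).toL1 (fun t => f (t + 0)) = hf.toL1 f := by
      simp only [add_zero]
    rw [h2, sub_self, norm_zero] at h1
    exact h1
  refine h0.congr fun h => ?_
  rw [← Integrable.toL1_sub, L1.norm_of_fun_eq_integral_norm]
  rfl

/-- The periodic comb `{t | N ∣ ⌊t / σ⌋}`, of density `1 / N`. -/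
def comb (N : ℕ) (σ : ℝ) : Set ℝ := {t | (N : ℤ) ∣ ⌊t / σ⌋}

theorem measurableSet_comb (N : ℕ) (σ : ℝ) : MeasurableSet (comb N σ) :=
  (Int.measurable_floor.comp (measurable_id.div_const σ))
    (MeasurableSet.of_discrete (s := {k : ℤ | (N : ℤ) ∣ k}))

/-- The translates of the comb by `iσ`, `i < N`, partition the line: exactly the index congruent to
`⌊t / σ⌋` modulo `N` contributes. -/
theorem sum_indicator_comb {Y : Type*} [AddCommGroup Y] {N : ℕ} (hN : 0 < N) {σ : ℝ}
    (hσ : 0 < σ) (f : ℝ → Y) (t : ℝ) :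
    ∑ i ∈ Finset.range N, (comb N σ).indicator (fun s => f (s + i * σ)) (t - i * σ) = f t := by
  have hN' : (0 : ℤ) < N := by exact_mod_cast hN
  set k : ℕ := (⌊t / σ⌋ % N).toNat with hk
  have hk' : (k : ℤ) = ⌊t / σ⌋ % N := Int.toNat_of_nonneg (Int.emod_nonneg _ hN'.ne')
  have hmem : ∀ i : ℕ, t - i * σ ∈ comb N σ ↔ (N : ℤ) ∣ ⌊t / σ⌋ - i := by
    intro i
    have : (t - i * σ) / σ = t / σ - (i : ℕ) := by field_simp
    change (N : ℤ) ∣ ⌊(t - i * σ) / σ⌋ ↔ _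
    rw [this, Int.floor_sub_natCast]
  rw [Finset.sum_eq_single k]
  · rw [indicator_of_mem, sub_add_cancel]
    rw [hmem, hk']
    exact Int.dvd_self_sub_emod
  · intro i hi hik
    refine indicator_of_notMem (fun hin => hik ?_) _
    rw [hmem] at hin
    have h2 : (⌊t / σ⌋ : ℤ) % N = (i : ℤ) % N :=
      Int.emod_eq_emod_iff_emod_sub_eq_zero.2 (Int.emod_eq_zero_of_dvd hin)
    rw [Int.emod_eq_of_lt (a := (i : ℤ)) (by positivity)
      (by exact_mod_cast Finset.mem_range.1 hi)] at h2
    have : (k : ℤ) = i := hk'.trans h2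
    exact_mod_cast this.symm
  · intro hnot
    exfalso
    apply hnot
    rw [Finset.mem_range]
    have : (k : ℤ) < N := hk' ▸ Int.emod_lt_of_pos _ hN'
    exact_mod_cast this

/-- By the partition, `∫ f` is a sum of `N` integrals over the comb of translates of `f`. The
translations tend to zero with the tooth width, so each integral approaches that of `f` itself by
`L¹` continuity of translation. -/
theorem tendsto_integral_comb {Y : Type*} [NormedAddCommGroup Y] [NormedSpace ℝ Y] {f : ℝ → Y}
    (hf : Integrable f) {N : ℕ} (hN : 0 < N) :
    Tendsto (fun j : ℕ => (N : ℝ) • ∫ t in comb N (1 / ((j : ℝ) + 1)), f t) atTop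
      (𝓝 (∫ t, f t)) := by
  rw [tendsto_iff_norm_sub_tendsto_zero]
  have hlim : Tendsto (fun j : ℕ => ∑ i ∈ Finset.range N,
      ∫ t, ‖f (t + i * (1 / ((j : ℝ) + 1))) - f t‖) atTop (𝓝 0) := by
    rw [← Finset.sum_const_zero (s := Finset.range N)]
    refine tendsto_finsetSum _ fun i _ => (tendsto_integral_norm_translation_sub hf).comp ?_
    simpa using tendsto_one_div_add_atTop_nhds_zero_nat.const_mul (i : ℝ)
  refine squeeze_zero (fun _ => norm_nonneg _) (fun j => ?_) hlim
  set σ : ℝ := 1 / ((j : ℝ) + 1)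
  have hσ : 0 < σ := by positivity
  have hm := measurableSet_comb N σ
  have hi : ∀ c : ℝ, Integrable (fun t => f (t + c)) := fun c => hf.comp_add_right c
  have e1 : ∫ t, f t = ∑ i ∈ Finset.range N, ∫ t in comb N σ, f (t + i * σ) := by
    have h1 : ∀ t, f t
      = ∑ i ∈ Finset.range N, (comb N σ).indicator (fun s => f (s + i * σ)) (t - i * σ) :=
      fun t => (sum_indicator_comb hN hσ f t).symm
    rw [integral_congr_ae (Eventually.of_forall h1), integral_finsetSum]
    · refine Finset.sum_congr rfl fun i _ => ?_
      rw [integral_sub_right_eq_self (fun t => (comb N σ).indicator (fun s => f (s + i * σ)) t),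
        integral_indicator hm]
    · exact fun i _ => ((hi _).indicator hm).comp_sub_right _
  have e2 : (N : ℝ) • ∫ t in comb N σ, f t = ∑ i ∈ Finset.range N, ∫ t in comb N σ, f t := by
    rw [Finset.sum_const, Finset.card_range, Nat.cast_smul_eq_nsmul]
  rw [e1, e2, ← Finset.sum_sub_distrib]
  refine (norm_sum_le _ _).trans (Finset.sum_le_sum fun i _ => ?_)
  rw [← integral_sub hf.integrableOn (hi _).integrableOn]
  refine (norm_integral_le_integral_norm _).trans ?_
  refine (setIntegral_le_integral (hf.sub (hi _)).norm
    (Eventually.of_forall fun _ => norm_nonneg _)).trans_eq ?_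
  exact integral_congr_ae (Eventually.of_forall fun t => norm_sub_rev _ _)

namespace C0Semigroup

variable {X : Type*} [NormedAddCommGroup X] [NormedSpace ℝ X] [CompleteSpace X]

/-- A fine comb works: for each `t` the convolution with `N · 1_E - 1` tends to zero, and it is
bounded uniformly in `t`, which gives the `L¹` statement. The measure of the set tends to `T / N`;
the factor `2` absorbs the error. -/
theorem exists_spike_set (S : C0Semigroup X) {T : ℝ} (hT : 0 < T) {h : ℝ → X}
    (hh : IntegrableOn h (Ioo 0 T)) {N : ℕ} (hN : 0 < N) {ε : ℝ} (hε : 0 < ε) :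
    ∃ E : Set ℝ, MeasurableSet E ∧ (volume (Ioo 0 T ∩ E)).toReal ≤ 2 * T / N ∧
      ‖∫ s in (0 : ℝ)..T, S.toFun (T - s) ((E.indicator (fun _ => (N : ℝ)) s - 1) • h s)‖ ≤ ε ∧
      (∫ t in Ioo 0 T, ‖∫ s in (0 : ℝ)..t,
        S.toFun (t - s) ((E.indicator (fun _ => (N : ℝ)) s - 1) • h s)‖) ≤ ε := by
  obtain ⟨M, hM1, hM⟩ := S.exists_bound T
  have hN' : (0 : ℝ) < N := by exact_mod_cast hN
  let E : ℕ → Set ℝ := fun j => comb N (1 / ((j : ℝ) + 1))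
  have hEm : ∀ j, MeasurableSet (E j) := fun j => measurableSet_comb _ _
  let q : ℕ → ℝ → X := fun j s => ((E j).indicator (fun _ => (N : ℝ)) s - 1) • h s
  have hq : ∀ j, q j = fun s => (E j).indicator (fun s => (N : ℝ) • h s) s - h s := by
    intro j
    ext s
    by_cases hs : s ∈ E j <;> simp [q, hs, sub_smul]
  have hqi : ∀ j, IntegrableOn (q j) (Ioo 0 T) := fun j => by
    rw [hq]
    exact ((hh.smul (N : ℝ)).indicator (hEm j)).sub hh
  have hqn : ∀ j s, ‖q j s‖ ≤ (N + 1) * ‖h s‖ := fun j s => by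
    rw [norm_smul]
    refine mul_le_mul_of_nonneg_right ((norm_sub_le _ _).trans ?_) (norm_nonneg _)
    rw [norm_one]
    refine add_le_add ((norm_indicator_le_norm_self _ _).trans ?_) le_rfl
    simp
  let a : ℕ → ℝ → X := fun j t => ∫ s in (0 : ℝ)..t, S.toFun (t - s) (q j s)
  have hac : ∀ j, ContinuousOn (a j) (Icc 0 T) := fun j => S.continuousOn_conv (hqi j)
  have hlim : ∀ t ∈ Icc 0 T, Tendsto (fun j => a j t) atTop (𝓝 0) := by
    intro t ht
    have hf : Integrable ((Ioo 0 t).indicator fun s => S.toFun (t - s) (h s)) := by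
      rw [integrable_indicator_iff measurableSet_Ioo]
      exact (intervalIntegrable_iff_integrableOn_Ioo_of_le ht.1).1
        (S.intervalIntegrable_conv hh ht)
    have h1 := (tendsto_integral_comb hf hN).sub_const
      (∫ s, (Ioo 0 t).indicator (fun s => S.toFun (t - s) (h s)) s)
    rw [sub_self] at h1
    refine h1.congr fun j => ?_
    change _ = ∫ s in (0 : ℝ)..t, S.toFun (t - s) (q j s)
    rw [← setIntegral_Ioo_eq_intervalIntegral ht.1, ← integral_indicator (hEm j), ← integral_smul,
      ← integral_sub (f := fun s => (N : ℝ) • (E j).indicator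
        ((Ioo 0 t).indicator fun s => S.toFun (t - s) (h s)) s)
        ((hf.indicator (hEm j)).smul (N : ℝ)) hf, ← integral_indicator measurableSet_Ioo]
    congr 1
    ext s
    by_cases hs : s ∈ Ioo 0 t <;> by_cases hs' : s ∈ E j
    · simp only [q, E, indicator_of_mem hs, indicator_of_mem (show s ∈ comb N _ from hs'), sub_smul,
        map_sub, map_smul, one_smul]
    · simp only [q, E, indicator_of_mem hs, indicator_of_notMem (show s ∉ comb N _ from hs'),
        sub_smul, map_sub, one_smul, zero_smul, smul_zero, _root_.map_zero]
    · simp only [q, E, indicator_of_notMem hs, indicator_of_mem (show s ∈ comb N _ from hs'),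
        smul_zero, sub_zero]
    · simp only [q, E, indicator_of_notMem hs, indicator_of_notMem (show s ∉ comb N _ from hs'),
        smul_zero, sub_zero]
  have hbound : ∀ j, ∀ t ∈ Icc 0 T, ‖a j t‖ ≤ M * ∫ s in Ioo 0 T, (N + 1) * ‖h s‖ := by
    intro j t ht
    have hi : IntegrableOn (fun s => (N + 1) * ‖h s‖) (Ioo 0 T) := hh.norm.const_mul _
    refine (S.norm_conv_le hM hi (Eventually.of_forall (hqn j)) ht).trans ?_
    gcongr
    exact intervalIntegral_le_setIntegral_Ioo ht hi (Eventually.of_forall fun s => by positivity)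
  have hint : Tendsto (fun j => ∫ t in Ioo 0 T, ‖a j t‖) atTop (𝓝 0) := by
    have := tendsto_integral_of_dominated_convergence (μ := volume.restrict (Ioo 0 T))
      (F := fun j t => ‖a j t‖) (f := fun _ => (0 : ℝ))
      (fun _ => M * ∫ s in Ioo 0 T, (N + 1) * ‖h s‖)
      (fun j => (integrableOn_Ioo_of_continuousOn (hac j).norm).aestronglyMeasurable)
      (integrable_const _)
      (fun j => by
        filter_upwards [ae_restrict_mem measurableSet_Ioo] with t ht
        rw [norm_norm]
        exact hbound j t (Ioo_subset_Icc_self ht)) (by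
        filter_upwards [ae_restrict_mem measurableSet_Ioo] with t ht
        simpa using (hlim t (Ioo_subset_Icc_self ht)).norm)
    simpa using this
  have hmeas : Tendsto (fun j => (N : ℝ) * (volume (Ioo 0 T ∩ E j)).toReal) atTop (𝓝 T) := by
    have h1 := tendsto_integral_comb (f := (Ioo 0 T).indicator fun _ => (1 : ℝ))
      ((integrable_indicator_iff measurableSet_Ioo).2 (integrableOn_const (by simp))) hN
    have e1 : ∫ t, (Ioo 0 T).indicator (fun _ => (1 : ℝ)) t = T := by
      rw [integral_indicator measurableSet_Ioo]
      simp [hT.le]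
    rw [e1] at h1
    refine h1.congr fun j => ?_
    rw [setIntegral_indicator measurableSet_Ioo, inter_comm]
    simp [Measure.real, E]
  have hev := ((hmeas.eventually (gt_mem_nhds (show T < 2 * T by linarith))).and
    (((hlim T ⟨hT.le, le_rfl⟩).norm.eventually
      (gt_mem_nhds (by simpa using hε))).and (hint.eventually (gt_mem_nhds hε)))).exists
  obtain ⟨j, h1, h2, h3⟩ := hev
  refine ⟨E j, hEm j, ?_, h2.le, h3.le⟩
  rw [le_div_iff₀ hN', mul_comm]
  exact h1.le

end C0Semigroup

namespace DriftHyp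

variable {X U : Type*} [NormedAddCommGroup X] [NormedSpace ℝ X] [CompleteSpace X]
  [MetricSpace U] [TopologicalSpace.SeparableSpace U] [MeasurableSpace U] [BorelSpace U]
  {T L : ℝ} {F : ℝ → X → U → X} {u v : ℝ → U} {y ξ : ℝ → X}

/-- First order expansion of the end point of a trajectory along spike variations. -/
theorem exists_spike_sequence (h : DriftHyp T L F) (hT : 0 < T) {S : C0Semigroup X} {y₀ : X}
    (hu : u ∈ controls U T) (hv : v ∈ controls U T) (hy : IsTrajectory S T F y₀ u y)
    (hξ : IsVariation S T F u y v ξ) :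
    ∃ w : ℕ → ℝ → U, (∀ n, w n ∈ controls U T) ∧
      (∀ n, ekelandDist T (w n) u ≤ 2 * T / ((n : ℝ) + 1)) ∧
      ∀ z : ℕ → ℝ → X, (∀ n, IsTrajectory S T F y₀ (w n) (z n)) →
        Tendsto (fun n : ℕ => ((n : ℝ) + 1) • (z n T - y T)) atTop (𝓝 (ξ T)) := by
  classical
  have hL := h.nonneg
  have hym := (integrableOn_Ioo_of_continuousOn hy.1).aestronglyMeasurable
  obtain ⟨R, hR⟩ := isCompact_Icc.exists_bound_of_continuousOn hy.1
  set d : ℝ → X := fun s => F s (y s) (v s) - F s (y s) (u s) with hd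
  have hdi : IntegrableOn d (Ioo 0 T) := by
    refine integrableOn_Ioo_of_bound (C := 2 * (L * R + L))
      ((h.aestronglyMeasurable_comp hym hv).sub (h.aestronglyMeasurable_comp hym hu)) ?_
    intro s hs
    have hs' := Ioo_subset_Icc_self hs
    have h1 := h.growth hs' (y s) (v s)
    have h2 := h.growth hs' (y s) (u s)
    have h3 := mul_le_mul_of_nonneg_left (hR s hs') hL
    exact (norm_sub_le _ _).trans (by linarith)
  have hN : ∀ n : ℕ, 0 < n + 1 := fun n => Nat.succ_pos n
  choose E hEm hEv hE1 hE2 using fun n : ℕ =>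
    S.exists_spike_set hT hdi (hN n) (ε := 1 / ((n : ℝ) + 1)) (by positivity)
  simp only [Nat.cast_add, Nat.cast_one] at hEv hE1 hE2
  have hdist : ∀ n, ekelandDist T ((E n).piecewise v u) u ≤ 2 * T / ((n : ℝ) + 1) := by
    refine fun n => (ENNReal.toReal_mono ?_ (measure_mono ?_)).trans (hEv n)
    · exact ((measure_mono inter_subset_left).trans_lt (by simp : volume (Ioo 0 T) < ⊤)).ne
    · rintro t ⟨ht, hne⟩
      refine ⟨ht, ?_⟩
      by_contra hnot
      exact hne (piecewise_eq_of_notMem _ _ _ hnot)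
  have hw : ∀ n, (E n).piecewise v u ∈ controls U T := by
    intro n
    obtain ⟨u', hu', huu'⟩ := hu
    obtain ⟨v', hv', hvv'⟩ := hv
    refine ⟨(E n).piecewise v' u', hv'.piecewise (hEm n) hu', ?_⟩
    filter_upwards [huu', hvv'] with s h1 h2
    by_cases hs : s ∈ E n <;> simp [hs, h1, h2]
  refine ⟨fun n => (E n).piecewise v u, hw, hdist, ?_⟩
  intro z hz
  obtain ⟨C, hC0, hC⟩ := h.exists_trajectory_lipschitz hT.le S y₀
  have hzy : ∀ n : ℕ, ∀ t ∈ Icc 0 T, ((n : ℝ) + 1) * ‖z n t - y t‖ ≤ 2 * C * T := by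
    intro n t ht
    have h1 := (hC _ _ _ _ (hz n) hy t ht).trans (mul_le_mul_of_nonneg_left (hdist n) hC0)
    have hn : (0 : ℝ) < (n : ℝ) + 1 := by positivity
    calc ((n : ℝ) + 1) * ‖z n t - y t‖ ≤ ((n : ℝ) + 1) * (C * (2 * T / ((n : ℝ) + 1))) := by
          gcongr
      _ = _ := by field_simp
  set K := 4 * L * C * T with hK
  have hK0 : 0 ≤ K := by positivity
  let A : ℝ → X →L[ℝ] X := fun s => fderiv ℝ (fun x => F s x (u s)) (y s)
  have hA : ∀ s ∈ Icc 0 T, ∀ x, ‖A s x‖ ≤ L * ‖x‖ := fun s hs x =>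
    (A s).le_of_opNorm_le (h.norm_fderiv_le s hs _ _) x
  let ind : ℕ → ℝ → ℝ := fun n => (E n).indicator fun _ => (n : ℝ) + 1
  -- The rescaled deviation `(n + 1)(z_n - y) - ξ` solves a linear integral equation with
  -- inhomogeneity `a n`, small by the choice of the spike set, and source `f n`; `c n` is the
  -- rescaled Taylor remainder at the control `u`.
  let a : ℕ → ℝ → X := fun n t => ∫ s in (0 : ℝ)..t, S.toFun (t - s) ((ind n s - 1) • d s)
  let c : ℕ → ℝ → ℝ := fun n s => ((n : ℝ) + 1) *
    ‖F s (z n s) (u s) - F s (y s) (u s) - A s (z n s - y s)‖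
  let f : ℕ → ℝ → X := fun n s => ((n : ℝ) + 1) • (F s (z n s) ((E n).piecewise v u s)
    - F s (y s) (u s)) - (A s (ξ s) + F s (y s) (v s) - F s (y s) (u s)) - (ind n s - 1) • d s
  have hai : ∀ n, IntegrableOn (fun s => (ind n s - 1) • d s) (Ioo 0 T) := by
    intro n
    have : (fun s => (ind n s - 1) • d s)
        = fun s => (E n).indicator (fun s => ((n : ℝ) + 1) • d s) s - d s := by
      ext s
      by_cases hs : s ∈ E n <;> simp [ind, hs, add_smul]
    rw [this]
    exact ((hdi.smul ((n : ℝ) + 1)).indicator (hEm n)).sub hdi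
  have hlipb : ∀ n : ℕ, ∀ s ∈ Ioo 0 T, ∀ p : U,
      ((n : ℝ) + 1) * ‖F s (z n s) p - F s (y s) p - A s (z n s - y s)‖ ≤ K := by
    intro n s hs p
    have hs' := Ioo_subset_Icc_self hs
    have h1 := h.lipschitz hs' (z n s) (y s) p
    have h2 := hA s hs' (z n s - y s)
    have h3 := mul_le_mul_of_nonneg_left (hzy n s hs') hL
    calc ((n : ℝ) + 1) * ‖F s (z n s) p - F s (y s) p - A s (z n s - y s)‖
        ≤ ((n : ℝ) + 1) * (L * ‖z n s - y s‖ + L * ‖z n s - y s‖) := by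
          gcongr
          exact (norm_sub_le _ _).trans (add_le_add h1 h2)
      _ = 2 * (L * (((n : ℝ) + 1) * ‖z n s - y s‖)) := by ring
      _ ≤ K := by rw [hK]; linarith
  have hzm : ∀ n, AEStronglyMeasurable (z n) (volume.restrict (Ioo 0 T)) := fun n =>
    (integrableOn_Ioo_of_continuousOn (hz n).1).aestronglyMeasurable
  have hcm : ∀ n, AEStronglyMeasurable (c n) (volume.restrict (Ioo 0 T)) := fun n =>
    ((((h.aestronglyMeasurable_comp (hzm n) hu).sub (h.aestronglyMeasurable_comp hym hu)).sub
      (h.aestronglyMeasurable_fderiv hym hu ((hzm n).sub hym))).norm.const_mul _)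
  have hc0 : ∀ n s, 0 ≤ c n s := fun n s => by positivity
  have hcK : ∀ n, ∀ s ∈ Ioo 0 T, ‖c n s‖ ≤ K := fun n s hs => by
    rw [Real.norm_of_nonneg (hc0 n s)]
    exact hlipb n s hs (u s)
  have hci : ∀ n, IntegrableOn (c n) (Ioo 0 T) := fun n =>
    integrableOn_Ioo_of_bound (hcm n) (hcK n)
  have hclim : Tendsto (fun n => ∫ s in Ioo 0 T, c n s) atTop (𝓝 0) := by
    have := tendsto_integral_of_dominated_convergence (μ := volume.restrict (Ioo 0 T))
      (F := c) (f := fun _ => (0 : ℝ)) (fun _ => K) hcm (integrable_const _)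
      (fun n => (ae_restrict_mem measurableSet_Ioo).mono (hcK n)) (by
        filter_upwards [ae_restrict_mem measurableSet_Ioo] with s hs
        have hs' := Ioo_subset_Icc_self hs
        have hfd : HasFDerivAt (fun x => F s x (u s)) (A s) (y s) :=
          (((h.contDiff s hs' (u s)).differentiable one_ne_zero) _).hasFDerivAt
        -- Differentiability makes the remainder `o(‖z_n - y‖)`, and `z_n - y` is of order `1 / n`,
        -- so the factor `n + 1` is harmless.
        have hO : (fun n => z n s - y s) =O[atTop] fun n : ℕ => 1 / ((n : ℝ) + 1) := by
          refine Asymptotics.IsBigO.of_bound (2 * C * T) (Eventually.of_forall fun n => ?_)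
          have hn : (0 : ℝ) < (n : ℝ) + 1 := by positivity
          rw [Real.norm_of_nonneg (by positivity), mul_one_div, le_div_iff₀ hn, mul_comm]
          exact hzy n s hs'
        have hzlim : Tendsto (fun n => z n s) atTop (𝓝 (y s)) := by
          rw [← tendsto_sub_nhds_zero_iff]
          exact hO.trans_tendsto tendsto_one_div_add_atTop_nhds_zero_nat
        have ho := ((hfd.isLittleO.comp_tendsto hzlim).trans_isBigO hO).norm_left
        have := ho.tendsto_div_nhds_zero
        refine this.congr fun n => ?_
        simp only [c, Function.comp_apply, div_div_eq_mul_div, div_one]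
        ring)
    simpa using this
  obtain ⟨D, hD0, hD⟩ := S.mild_estimate hT.le hL
  have hest : ∀ n : ℕ, ‖((n : ℝ) + 1) • (z n T - y T) - ξ T‖ ≤ 1 / ((n : ℝ) + 1) +
      D * (1 / ((n : ℝ) + 1) + ((∫ s in Ioo 0 T, c n s) + K * (2 * T / ((n : ℝ) + 1)))) := by
    intro n
    have hKi : IntegrableOn ((E n).indicator fun _ => K) (Ioo 0 T) :=
      (integrableOn_const (by simp)).indicator (hEm n)
    have key := hD (fun t => ((n : ℝ) + 1) • (z n t - y t) - ξ t) (a n) (f n)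
      (fun s => c n s + (E n).indicator (fun _ => K) s)
      ((((hz n).1.sub hy.1).const_smul _).sub hξ.1) (S.continuousOn_conv (hai n))
      ((hci n).add hKi) (Eventually.of_forall fun s =>
        add_nonneg (hc0 n s) (indicator_nonneg (fun _ _ => hK0) s)) (by
        filter_upwards [ae_restrict_mem measurableSet_Ioo] with s hs
        have hs' := Ioo_subset_Icc_self hs
        have hn : (0 : ℝ) ≤ (n : ℝ) + 1 := by positivity
        -- The jump of the drift at `y` from `u` to `v`, times `n + 1`, cancels exactly against `ind
        -- n s • d s`. On the spike set the remainder is taken at `v` while `A` is the derivative at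
        -- `u`, so it is merely bounded by `K`; the measure of the set, of order `1 / n`, makes up
        -- for this.
        have e : f n s = A s (((n : ℝ) + 1) • (z n s - y s) - ξ s) + ((n : ℝ) + 1) •
            (F s (z n s) ((E n).piecewise v u s) - F s (y s) ((E n).piecewise v u s)
              - A s (z n s - y s)) := by
          by_cases hsE : s ∈ E n
          · simp only [f, ind, d, piecewise_eq_of_mem _ _ _ hsE, indicator_of_mem hsE, map_sub,
              map_smul]
            module
          · simp only [f, ind, d, piecewise_eq_of_notMem _ _ _ hsE, indicator_of_notMem hsE,
              map_sub, map_smul]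
            module
        rw [e]
        refine (norm_add_le _ _).trans (add_le_add (hA s hs' _) ?_)
        rw [norm_smul, Real.norm_of_nonneg hn]
        by_cases hsE : s ∈ E n
        · rw [piecewise_eq_of_mem _ _ _ hsE, indicator_of_mem hsE]
          linarith [hlipb n s hs (v s), hc0 n s]
        · rw [piecewise_eq_of_notMem _ _ _ hsE, indicator_of_notMem hsE, add_zero]) (by
        intro t ht
        have hi1 : IntervalIntegrable (fun s => ((n : ℝ) + 1) • S.toFun (t - s)
            (F s (z n s) ((E n).piecewise v u s) - F s (y s) (u s))) volume 0 t :=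
          (S.intervalIntegrable_conv ((hz n).2.1.sub hy.2.1) ht).smul _
        have hi2 : IntervalIntegrable (fun s => S.toFun (t - s)
            (A s (ξ s) + F s (y s) (v s) - F s (y s) (u s))) volume 0 t :=
          S.intervalIntegrable_conv hξ.2.1 ht
        have hi3 := S.intervalIntegrable_conv (hai n) ht
        have e2 : ξ t = ∫ s in (0 : ℝ)..t, S.toFun (t - s)
            (A s (ξ s) + F s (y s) (v s) - F s (y s) (u s)) := by
          rw [hξ.2.2 t ht, map_zero, zero_add]
        have e1 : z n t - y t = ∫ s in (0 : ℝ)..t, S.toFun (t - s)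
            (F s (z n s) ((E n).piecewise v u s) - F s (y s) (u s)) := (hz n).sub_eq hy ht
        have e3 : ∫ s in (0 : ℝ)..t, S.toFun (t - s) (f n s)
            = ((n : ℝ) + 1) • (z n t - y t) - ξ t - a n t := by
          rw [e1, e2, ← intervalIntegral.integral_smul,
            ← intervalIntegral.integral_sub hi1 hi2,
            ← intervalIntegral.integral_sub (hi1.sub hi2) hi3]
          refine intervalIntegral.integral_congr fun s _ => ?_
          simp only [f, map_sub, map_smul]
        rw [e3]
        abel) T ⟨hT.le, le_rfl⟩
    have hKint : ∫ s in Ioo 0 T, (E n).indicator (fun _ => K) s ≤ K * (2 * T / ((n : ℝ) + 1)) := by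
      rw [setIntegral_indicator (hEm n), setIntegral_const, smul_eq_mul, mul_comm]
      exact mul_le_mul_of_nonneg_left (hEv n) hK0
    rw [integral_add (hci n) hKi] at key
    refine key.trans (add_le_add (hE1 n) (mul_le_mul_of_nonneg_left ?_ hD0))
    exact add_le_add (hE2 n) (by linarith)
  rw [tendsto_iff_norm_sub_tendsto_zero]
  refine squeeze_zero (fun _ => norm_nonneg _) hest ?_
  have h1 := tendsto_one_div_add_atTop_nhds_zero_nat (𝕜 := ℝ)
  have h2 : Tendsto (fun n : ℕ => K * (2 * T / ((n : ℝ) + 1))) atTop (𝓝 0) := by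
    have := h1.const_mul (K * (2 * T))
    rw [mul_zero] at this
    refine this.congr fun n => by ring
  simpa using h1.add ((h1.add (hclim.add h2)).const_mul D)

omit [TopologicalSpace.SeparableSpace U] [MeasurableSpace U] [BorelSpace U] in
theorem exists_variation_bound (h : DriftHyp T L F) (hT : 0 ≤ T) (S : C0Semigroup X) (u : ℝ → U)
    (hy : ContinuousOn y (Icc 0 T)) :
    ∃ Q : ℝ, 0 ≤ Q ∧ ∀ (v : ℝ → U) (ξ : ℝ → X), IsVariation S T F u y v ξ →
      ∀ t ∈ Icc 0 T, ‖ξ t‖ ≤ Q := by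
  have hL := h.nonneg
  obtain ⟨R, hR⟩ := isCompact_Icc.exists_bound_of_continuousOn hy
  obtain ⟨D, hD0, hD⟩ := S.mild_estimate hT hL
  have hR0 : 0 ≤ R := (norm_nonneg _).trans (hR 0 ⟨le_rfl, hT⟩)
  refine ⟨D * ∫ s in Ioo 0 T, 2 * (L * R + L), mul_nonneg hD0 (integral_nonneg fun _ => by
    positivity), fun v ξ hξ t ht => ?_⟩
  have := hD ξ (fun _ => 0)
    (fun s => fderiv ℝ (fun x => F s x (u s)) (y s) (ξ s) + F s (y s) (v s) - F s (y s) (u s))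
    (fun _ => 2 * (L * R + L)) hξ.1 continuousOn_const (integrableOn_const (by simp))
    (Eventually.of_forall fun _ => by positivity) (by
      filter_upwards [ae_restrict_mem measurableSet_Ioo] with s hs
      have hs' := Ioo_subset_Icc_self hs
      rw [add_sub_assoc]
      refine (norm_add_le _ _).trans (add_le_add (ContinuousLinearMap.le_of_opNorm_le _
        (h.norm_fderiv_le s hs' _ _) _) ((norm_sub_le _ _).trans ?_))
      have h1 := h.growth hs' (y s) (u s)
      have h2 := h.growth hs' (y s) (v s)
      have h3 := mul_le_mul_of_nonneg_left (hR s hs') hL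
      linarith)
    (fun t ht => by rw [hξ.2.2 t ht, map_zero]) t ht
  simpa using this

/-- Variations depend continuously on the reference pair, uniformly in the direction. -/
theorem tendsto_variation_sub (h : DriftHyp T L F) (hT : 0 < T) {S : C0Semigroup X} {y₀ : X}
    (hu : u ∈ controls U T) (hy : IsTrajectory S T F y₀ u y)
    {uk vk : ℕ → ℝ → U} {yk ξk ζk : ℕ → ℝ → X} (huk : ∀ k, uk k ∈ controls U T)
    (hyk : ∀ k, IsTrajectory S T F y₀ (uk k) (yk k))
    (hsum : Summable fun k => ekelandDist T (uk k) u)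
    (hξk : ∀ k, IsVariation S T F (uk k) (yk k) (vk k) (ξk k))
    (hζk : ∀ k, IsVariation S T F u y (vk k) (ζk k)) :
    Tendsto (fun k => ξk k T - ζk k T) atTop (𝓝 0) := by
  have hL := h.nonneg
  obtain ⟨C, hC0, hC⟩ := h.exists_trajectory_lipschitz hT.le S y₀
  obtain ⟨R, hR0, hR⟩ := h.exists_trajectory_bound hT.le S y₀
  obtain ⟨D, hD0, hD⟩ := S.mild_estimate hT.le hL
  have hm : ∀ {f : ℝ → X}, ContinuousOn f (Icc 0 T) →
    AEStronglyMeasurable f (volume.restrict (Ioo 0 T)) := fun hf =>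
      (integrableOn_Ioo_of_continuousOn hf).aestronglyMeasurable
  have hgr : ∀ s ∈ Icc 0 T, ∀ x : X, ‖x‖ ≤ R → ∀ x' : X, ‖x'‖ ≤ R → ∀ p p' : U,
      ‖F s x p - F s x' p'‖ ≤ 2 * (L * R + L) := by
    intro s hs x hx x' hx' p p'
    have h1 := h.growth hs x p
    have h2 := h.growth hs x' p'
    have h3 := mul_le_mul_of_nonneg_left hx hL
    have h4 := mul_le_mul_of_nonneg_left hx' hL
    exact (norm_sub_le _ _).trans (by linarith)
  have hylim : ∀ t ∈ Icc 0 T, Tendsto (fun k => ‖yk k t - y t‖) atTop (𝓝 0) := fun t ht =>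
    squeeze_zero (fun _ => norm_nonneg _) (fun k => hC _ _ _ _ (hyk k) hy t ht)
      (by simpa using hsum.tendsto_atTop_zero.const_mul C)
  -- Borel–Cantelli, from summability of the distances. Pointwise the control is then eventually
  -- constant, and continuity of the derivative in the state is enough to pass to the limit.
  have hev : ∀ᵐ s ∂(volume.restrict (Ioo 0 T)), ∀ᶠ k in atTop, uk k s = u s := by
    have h1 : (∑' k, volume {t : ℝ | t ∈ Ioo 0 T ∧ uk k t ≠ u t}) ≠ ⊤ := by
      have h2 := hsum.tsum_ofReal_ne_top
      refine ne_of_eq_of_ne (tsum_congr fun k => ?_) h2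
      exact (ENNReal.ofReal_toReal (volume_disagree_ne_top T (uk k) u)).symm
    filter_upwards [ae_restrict_of_ae (ae_eventually_notMem h1),
      ae_restrict_mem measurableSet_Ioo] with s hs hsT
    filter_upwards [hs] with k hk
    by_contra hne
    exact hk ⟨hsT, hne⟩
  let A : ℝ → X →L[ℝ] X := fun s => fderiv ℝ (fun x => F s x (u s)) (y s)
  let Ak : ℕ → ℝ → X →L[ℝ] X := fun k s => fderiv ℝ (fun x => F s x (uk k s)) (yk k s)
  have hA : ∀ s ∈ Icc 0 T, ∀ x, ‖A s x‖ ≤ L * ‖x‖ := fun s hs x =>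
    (A s).le_of_opNorm_le (h.norm_fderiv_le s hs _ _) x
  have hAk : ∀ k, ∀ s ∈ Icc 0 T, ∀ x, ‖Ak k s x‖ ≤ L * ‖x‖ := fun k s hs x =>
    (Ak k s).le_of_opNorm_le (h.norm_fderiv_le s hs _ _) x
  obtain ⟨Q, hQ0, hQ⟩ := h.exists_variation_bound hT.le S u hy.1
  -- Both variations use the same `vk k`, so the drift at `vk k` contributes only the Lipschitz
  -- term; together with the bound `Q` on all variations this gives uniformity in the direction.
  let b : ℕ → ℝ → ℝ := fun k s => ‖Ak k s (ζk k s) - A s (ζk k s)‖ + L * ‖yk k s - y s‖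
    + ‖F s (yk k s) (uk k s) - F s (y s) (u s)‖
  have hb0 : ∀ k s, 0 ≤ b k s := fun k s => by positivity
  have hbm : ∀ k, AEStronglyMeasurable (b k) (volume.restrict (Ioo 0 T)) := fun k =>
    (((h.aestronglyMeasurable_fderiv (hm (hyk k).1) (huk k) (hm (hζk k).1)).sub
      (h.aestronglyMeasurable_fderiv (hm hy.1) hu (hm (hζk k).1))).norm.add
      (((hm (hyk k).1).sub (hm hy.1)).norm.const_mul L)).add
      ((h.aestronglyMeasurable_comp (hm (hyk k).1) (huk k)).sub
        (h.aestronglyMeasurable_comp (hm hy.1) hu)).norm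
  have hbK : ∀ k, ∀ s ∈ Ioo 0 T, ‖b k s‖ ≤ (L * Q + L * Q) + L * (R + R) + 2 * (L * R + L) := by
    intro k s hs
    have hs' := Ioo_subset_Icc_self hs
    have h1 := hR _ _ (hyk k) s hs'
    have h2 := hR _ _ hy s hs'
    rw [Real.norm_of_nonneg (hb0 k s)]
    refine add_le_add (add_le_add ?_ ?_) (hgr s hs' _ h1 _ h2 _ _)
    · refine (norm_sub_le _ _).trans (add_le_add ((hAk k s hs' _).trans ?_)
        ((hA s hs' _).trans ?_))
      · exact mul_le_mul_of_nonneg_left (hQ _ _ (hζk k) s hs') hL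
      · exact mul_le_mul_of_nonneg_left (hQ _ _ (hζk k) s hs') hL
    · exact mul_le_mul_of_nonneg_left ((norm_sub_le _ _).trans (add_le_add h1 h2)) hL
  have hbi : ∀ k, IntegrableOn (b k) (Ioo 0 T) := fun k =>
    integrableOn_Ioo_of_bound (hbm k) (hbK k)
  have hblim : Tendsto (fun k => ∫ s in Ioo 0 T, b k s) atTop (𝓝 0) := by
    have := tendsto_integral_of_dominated_convergence (μ := volume.restrict (Ioo 0 T))
      (F := b) (f := fun _ => (0 : ℝ)) (fun _ => (L * Q + L * Q) + L * (R + R) + 2 * (L * R + L))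
      hbm (integrable_const _)
      (fun k => (ae_restrict_mem measurableSet_Ioo).mono (hbK k)) (by
        filter_upwards [ae_restrict_mem measurableSet_Ioo, hev] with s hs hus
        have hs' := Ioo_subset_Icc_self hs
        have hyl := hylim s hs'
        have h1 : Tendsto (fun k => ‖fderiv ℝ (fun x => F s x (u s)) (yk k s) - A s‖ * Q) atTop
            (𝓝 0) := by
          have hc := (h.continuous_fderiv s hs').comp (Continuous.prodMk_left (u s))
          have h2 := ((hc.tendsto (y s)).comp (tendsto_iff_norm_sub_tendsto_zero.2 hyl))
          have h3 := (tendsto_iff_norm_sub_tendsto_zero.1 h2).mul_const Q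
          rw [zero_mul] at h3
          exact h3
        have h4 := (h1.add (hyl.const_mul L)).add (hyl.const_mul L)
        simp only [mul_zero, add_zero] at h4
        refine squeeze_zero' (Eventually.of_forall fun k => hb0 k s) ?_ h4
        filter_upwards [hus] with k hk
        refine add_le_add (add_le_add ?_ le_rfl) ?_
        · simp only [Ak, hk]
          rw [← sub_apply]
          exact (ContinuousLinearMap.le_opNorm _ _).trans
            (mul_le_mul_of_nonneg_left (hQ _ _ (hζk k) s hs') (norm_nonneg _))
        · rw [hk]
          exact h.lipschitz hs' _ _ _)
    simpa using this
  rw [tendsto_zero_iff_norm_tendsto_zero]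
  refine squeeze_zero (fun _ => norm_nonneg _) (fun k => ?_) (by simpa using hblim.const_mul D)
  have := hD (fun t => ξk k t - ζk k t) (fun _ => 0)
    (fun s => (Ak k s (ξk k s) + F s (yk k s) (vk k s) - F s (yk k s) (uk k s))
      - (A s (ζk k s) + F s (y s) (vk k s) - F s (y s) (u s))) (b k)
    ((hξk k).1.sub (hζk k).1) continuousOn_const (hbi k) (Eventually.of_forall (hb0 k)) (by
      filter_upwards [ae_restrict_mem measurableSet_Ioo] with s hs
      have hs' := Ioo_subset_Icc_self hs
      have e : (Ak k s (ξk k s) + F s (yk k s) (vk k s) - F s (yk k s) (uk k s))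
          - (A s (ζk k s) + F s (y s) (vk k s) - F s (y s) (u s))
          = Ak k s (ξk k s - ζk k s) + ((Ak k s (ζk k s) - A s (ζk k s))
            + (F s (yk k s) (vk k s) - F s (y s) (vk k s))
            - (F s (yk k s) (uk k s) - F s (y s) (u s))) := by
        rw [map_sub]; abel
      rw [e]
      refine (norm_add_le _ _).trans (add_le_add (hAk k s hs' _) ((norm_sub_le _ _).trans ?_))
      exact add_le_add ((norm_add_le _ _).trans (add_le_add le_rfl
        (h.lipschitz hs' _ _ _))) le_rfl)
    (fun t ht => by rw [zero_add]; exact (hξk k).sub_eq (hζk k) ht) T ⟨hT.le, le_rfl⟩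
  simpa using this

end DriftHyp

/-! ### Ekeland's principle and completeness of the space of controls. -/

/-- **Ekeland's variational principle**. -/
theorem ekeland_variational_principle {α : Type*} [PseudoMetricSpace α] [CompleteSpace α]
    {f : α → ℝ} (hf : LowerSemicontinuous f) (hbdd : BddBelow (range f)) (x₀ : α) {ε : ℝ}
    (hε : 0 < ε) :
    ∃ x, f x + ε * dist x x₀ ≤ f x₀ ∧ ∀ z, f x ≤ f z + ε * dist z x := by
  let A : α → Set α := fun x => {z | f z + ε * dist z x ≤ f x}
  have hA : ∀ x, x ∈ A x := fun x => by simp [A]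
  have htrans : ∀ {x y z}, y ∈ A x → z ∈ A y → z ∈ A x := by
    intro x y z hy hz
    have h1 : f y + ε * dist y x ≤ f x := hy
    have h2 : f z + ε * dist z y ≤ f y := hz
    have h3 := mul_le_mul_of_nonneg_left (dist_triangle z y x) hε.le
    change f z + ε * dist z x ≤ f x
    linarith
  have hcl : ∀ x, IsClosed (A x) := fun x =>
    (hf.add (Continuous.lowerSemicontinuous (by fun_prop :
      Continuous fun z => ε * dist z x))).isClosed_preimage (f x)
  have hstep : ∀ (n : ℕ) (x : α), ∃ y ∈ A x, ∀ z ∈ A x, f y ≤ f z + 1 / ((n : ℝ) + 1) := by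
    intro n x
    have hb : BddBelow (f '' A x) := hbdd.mono (image_subset_range _ _)
    obtain ⟨_, ⟨y, hy, rfl⟩, hlt⟩ := exists_lt_of_csInf_lt (s := f '' A x) ⟨_, x, hA x, rfl⟩
      (lt_add_of_pos_right (sInf (f '' A x)) (by positivity : (0 : ℝ) < 1 / ((n : ℝ) + 1)))
    exact ⟨y, hy, fun z hz => hlt.le.trans (by gcongr; exact csInf_le hb ⟨z, hz, rfl⟩)⟩
  choose nxt hnxt hmin using hstep
  let x : ℕ → α := fun n => Nat.rec x₀ (fun n p => nxt n p) n
  have hx : ∀ n, x (n + 1) = nxt n (x n) := fun n => rfl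
  have hmem : ∀ n m, n ≤ m → x m ∈ A (x n) := by
    intro n m hnm
    induction m, hnm using Nat.le_induction with
    | base => exact hA _
    | succ m _ ih => exact htrans ih (hx m ▸ hnxt m (x m))
  have hdec : Antitone fun n => f (x n) := fun n m hnm => by
    have h1 : f (x m) + ε * dist (x m) (x n) ≤ f (x n) := hmem n m hnm
    have : 0 ≤ ε * dist (x m) (x n) := by positivity
    change f (x m) ≤ f (x n)
    linarith
  have hbx : BddBelow (range fun n => f (x n)) :=
    hbdd.mono (range_subset_iff.2 fun n => mem_range_self (x n))
  set l := ⨅ n, f (x n)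
  have hl : Tendsto (fun n => f (x n)) atTop (𝓝 l) := tendsto_atTop_ciInf hdec hbx
  have hle : ∀ n, l ≤ f (x n) := fun n => ciInf_le hbx n
  have hcau : CauchySeq x := by
    refine cauchySeq_of_le_tendsto_0' (fun n => (f (x n) - l) / ε) (fun n m hnm => ?_) ?_
    · have h1 : f (x m) + ε * dist (x m) (x n) ≤ f (x n) := hmem n m hnm
      rw [le_div_iff₀ hε, dist_comm, mul_comm]
      linarith [hle m]
    · simpa using (hl.sub_const l).div_const ε
  obtain ⟨p, hp⟩ := cauchySeq_tendsto_of_complete hcau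
  have hpA : ∀ n, p ∈ A (x n) := fun n =>
    (hcl _).mem_of_tendsto hp ((eventually_ge_atTop n).mono fun m hm => hmem n m hm)
  refine ⟨p, hpA 0, fun z => ?_⟩
  -- A point of `A p` lies in every `A (x n)`, on which the next iterate is an almost minimizer; in
  -- the limit its value is at least `l ≥ f p`. Outside `A p` the claim is the definition of `A`.
  by_cases hz : z ∈ A p
  · have h1 : l ≤ f z := by
      refine le_of_tendsto_of_tendsto (hl.comp (tendsto_add_atTop_nat 1))
        (by simpa only [add_zero] using tendsto_one_div_add_atTop_nhds_zero_nat.const_add (f z))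
        (Eventually.of_forall fun n => ?_)
      exact hmin n (x n) z (htrans (hpA n) hz)
    have h2 : f p ≤ l := ge_of_tendsto' hl fun n => by
      have h3 : f p + ε * dist p (x n) ≤ f (x n) := hpA n
      have : 0 ≤ ε * dist p (x n) := by positivity
      linarith
    have : 0 ≤ ε * dist z p := by positivity
    linarith
  · exact (not_le.1 (show ¬ f z + ε * dist z p ≤ f p from hz)).le

/-- The set of controls as a type, to be equipped with the Ekeland metric. -/
structure ControlSpace (U : Type*) [MeasurableSpace U] (T : ℝ) where
  toFun : ℝ → U
  mem_controls : toFun ∈ controls U T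

noncomputable instance ControlSpace.instPseudoMetricSpace (U : Type*) [MeasurableSpace U]
    (T : ℝ) : PseudoMetricSpace (ControlSpace U T) where
  dist u v := ekelandDist T u.1 v.1
  dist_self u := ekelandDist_self T u.1
  dist_comm u v := ekelandDist_comm T u.1 v.1
  dist_triangle u v w := ekelandDist_triangle T u.1 v.1 w.1

/-- Along a rapidly Cauchy sequence consecutive controls differ on sets of summable measure, so by
Borel–Cantelli almost every point sees an eventually constant sequence. The eventual values form the
limit; completeness of `U` plays no role. -/
instance ControlSpace.instCompleteSpace (U : Type*) [MetricSpace U] [MeasurableSpace U]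
    [BorelSpace U] (T : ℝ) : CompleteSpace (ControlSpace U T) := by
  classical
  refine Metric.complete_of_convergent_controlled_sequences (fun n => (1 / 2 : ℝ) ^ n)
    (fun n => by positivity) fun u hu => ?_
  let D : ℕ → Set ℝ := fun n => {t | t ∈ Ioo 0 T ∧ (u n).1 t ≠ (u (n + 1)).1 t}
  have hsum : (∑' n, volume (D n)) ≠ ⊤ := by
    have h1 : Summable fun n => ekelandDist T (u n).1 (u (n + 1)).1 :=
      Summable.of_nonneg_of_le (fun n => ekelandDist_nonneg _ _ _)
        (fun n => (hu n n (n + 1) le_rfl (Nat.le_succ n)).le) summable_geometric_two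
    refine ne_of_eq_of_ne (tsum_congr fun n => ?_) h1.tsum_ofReal_ne_top
    exact (ENNReal.ofReal_toReal (volume_disagree_ne_top T _ _)).symm
  let w : ℝ → U := fun t => if h : ∃ p, ∀ᶠ n in atTop, (u n).1 t = p then h.choose else (u 0).1 t
  have hw : ∀ n, ∀ t ∈ Ioo 0 T, (∀ m, n ≤ m → t ∉ D m) → ∀ m, n ≤ m → (u m).1 t = w t := by
    intro n t ht hD
    have hst : ∀ m, n ≤ m → (u m).1 t = (u n).1 t := by
      intro m hm
      induction m, hm using Nat.le_induction with
      | base => rfl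
      | succ m hm ih =>
        rw [← ih]
        by_contra hne
        exact hD m hm ⟨ht, fun h => hne h.symm⟩
    have hex : ∃ p, ∀ᶠ m in atTop, (u m).1 t = p :=
      ⟨_, (eventually_ge_atTop n).mono hst⟩
    have hwt : w t = hex.choose := dif_pos hex
    obtain ⟨m, hm1, hm2⟩ := (hex.choose_spec.and (eventually_ge_atTop n)).exists
    intro k hk
    rw [hwt, ← hm1, hst m hm2, hst k hk]
  have hwm : w ∈ controls U T := by
    refine aemeasurable_of_tendsto_metrizable_ae atTop (fun n => (u n).2) ?_
    filter_upwards [ae_restrict_of_ae (ae_eventually_notMem hsum),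
      ae_restrict_mem measurableSet_Ioo] with t ht htT
    obtain ⟨n, hn⟩ := eventually_atTop.1 ht
    exact tendsto_const_nhds.congr'
      ((eventually_ge_atTop n).mono fun m hm => (hw n t htT hn m hm).symm)
  refine ⟨⟨w, hwm⟩, ?_⟩
  rw [tendsto_iff_dist_tendsto_zero]
  have htail := ENNReal.tendsto_sum_nat_add (fun n => volume (D n)) hsum
  have htail' := (ENNReal.tendsto_toReal ENNReal.zero_ne_top).comp htail
  refine squeeze_zero (fun _ => dist_nonneg) (fun n => ?_) htail'
  refine ENNReal.toReal_mono ?_ ((measure_mono ?_).trans (measure_iUnion_le fun k => D (k + n)))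
  · exact ne_top_of_le_ne_top hsum (ENNReal.tsum_comp_le_tsum_of_injective
      (add_left_injective n) _)
  · rintro t ⟨ht, hne⟩
    by_contra hnot
    rw [mem_iUnion, not_exists] at hnot
    refine hne (hw n t ht (fun m hm => ?_) n le_rfl)
    have := hnot (m - n)
    rwa [Nat.sub_add_cancel hm] at this

namespace DriftHyp

variable {X U : Type*} [NormedAddCommGroup X] [NormedSpace ℝ X] [CompleteSpace X]
  [MetricSpace U] [TopologicalSpace.SeparableSpace U] [MeasurableSpace U] [BorelSpace U]
  {T L : ℝ} {F : ℝ → X → U → X} {u v : ℝ → U} {y ξ : ℝ → X}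

/-- For each `k` a violating direction is selected if there is one; convergence along this sequence
of directions rules out violations for large `k`. -/
theorem eventually_variation_sub_le (h : DriftHyp T L F) (hT : 0 < T) {S : C0Semigroup X}
    {y₀ : X} (hu : u ∈ controls U T) (hy : IsTrajectory S T F y₀ u y)
    {uk : ℕ → ℝ → U} {yk : ℕ → ℝ → X} (huk : ∀ k, uk k ∈ controls U T)
    (hyk : ∀ k, IsTrajectory S T F y₀ (uk k) (yk k))
    (hsum : Summable fun k => ekelandDist T (uk k) u) {ε : ℝ} (hε : 0 < ε) :
    ∀ᶠ k in atTop, ∀ v ∈ controls U T, ∀ ξ ζ, IsVariation S T F (uk k) (yk k) v ξ →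
      IsVariation S T F u y v ζ → ‖ξ T - ζ T‖ ≤ ε := by
  classical
  have hex : ∀ k, ∃ v ξ ζ, IsVariation S T F (uk k) (yk k) v ξ ∧ IsVariation S T F u y v ζ ∧
      (‖ξ T - ζ T‖ ≤ ε → ∀ v ∈ controls U T, ∀ ξ ζ, IsVariation S T F (uk k) (yk k) v ξ →
      IsVariation S T F u y v ζ → ‖ξ T - ζ T‖ ≤ ε) := by
    intro k
    by_cases hk : ∀ v ∈ controls U T, ∀ ξ ζ, IsVariation S T F (uk k) (yk k) v ξ →
      IsVariation S T F u y v ζ → ‖ξ T - ζ T‖ ≤ ε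
    · obtain ⟨ξ, hξ⟩ := h.exists_variation hT.le S (huk k) hu (hyk k).1
      obtain ⟨ζ, hζ⟩ := h.exists_variation hT.le S hu hu hy.1
      exact ⟨u, ξ, ζ, hξ, hζ, fun _ => hk⟩
    · push Not at hk
      obtain ⟨v, -, ξ, ζ, hξ, hζ, hlt⟩ := hk
      exact ⟨v, ξ, ζ, hξ, hζ, fun hle => absurd hle (not_le.2 hlt)⟩
  choose vk ξk ζk hξk hζk himp using hex
  have := h.tendsto_variation_sub hT hu hy huk hyk hsum hξk hζk
  have h1 := (tendsto_zero_iff_norm_tendsto_zero.1 this).eventually (gt_mem_nhds hε)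
  filter_upwards [h1] with k hk
  exact himp k hk.le

end DriftHyp

/-! ### Hilbert space: distance functions, weak limits and finite codimension. -/

section Hilbert

variable {H : Type*} [NormedAddCommGroup H] [InnerProductSpace ℝ H]

/-- The direction of steepest ascent of the distance to `K`, tested along a curve. -/
theorem neg_mul_norm_le_inner_of_infDist_le {K : Set H} {q π w : H} {c : ℝ} (hπ : π ∈ K)
    (hq : Metric.infDist q K = ‖q - π‖) {p : ℕ → H}
    (hp : Tendsto (fun n : ℕ => ((n : ℝ) + 1) • (p n - q)) atTop (𝓝 w))
    (hle : ∀ n : ℕ, Metric.infDist q K ≤ Metric.infDist (p n) K + c / ((n : ℝ) + 1)) :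
    -(c * ‖q - π‖) ≤ inner ℝ (q - π) w := by
  set a := q - π
  have h0 : Tendsto (fun n => p n - q) atTop (𝓝 0) := by
    have := (tendsto_one_div_add_atTop_nhds_zero_nat (𝕜 := ℝ)).smul hp
    rw [zero_smul] at this
    refine this.congr fun n => ?_
    rw [smul_smul, one_div_mul_cancel (by positivity), one_smul]
  have hlim : Tendsto (fun n : ℕ => inner ℝ a (((n : ℝ) + 1) • (p n - q)) +
      inner ℝ (((n : ℝ) + 1) • (p n - q)) (p n - q) / 2) atTop (𝓝 (inner ℝ a w)) := by
    have := ((tendsto_const_nhds (x := a)).inner (𝕜 := ℝ) hp).add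
      ((hp.inner (𝕜 := ℝ) h0).div_const 2)
    simpa using this
  refine ge_of_tendsto' hlim fun n => ?_
  have hn : (0 : ℝ) < (n : ℝ) + 1 := by positivity
  -- The fixed point `π` is a competitor for the distance from `p n`, so the derivative of the
  -- distance is not needed.
  have h1 : ‖a‖ ≤ ‖a + (p n - q)‖ + c / ((n : ℝ) + 1) := by
    have h2 := Metric.infDist_le_dist_of_mem (x := p n) hπ
    have h3 := hle n
    have e : a + (p n - q) = p n - π := by simp only [a]; abel
    rw [dist_eq_norm] at h2
    rw [e, ← hq]
    linarith
  have h2 : ‖a + (p n - q)‖ ^ 2 = ‖a‖ ^ 2 + 2 * inner ℝ a (p n - q) + ‖p n - q‖ ^ 2 :=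
    norm_add_sq_real _ _
  rw [inner_smul_right, inner_smul_left, real_inner_self_eq_norm_sq]
  simp only [conj_trivial]
  have h3 : ‖a‖ * ‖a‖ ≤ ‖a‖ * (‖a + (p n - q)‖ + c / ((n : ℝ) + 1)) :=
    mul_le_mul_of_nonneg_left h1 (norm_nonneg _)
  have h4 : ‖a‖ * ‖a + (p n - q)‖ ≤ (‖a‖ ^ 2 + ‖a + (p n - q)‖ ^ 2) / 2 := by
    nlinarith [sq_nonneg (‖a‖ - ‖a + (p n - q)‖)]
  have h5 : -(c / ((n : ℝ) + 1) * ‖a‖) ≤ inner ℝ a (p n - q) + ‖p n - q‖ ^ 2 / 2 := by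
    nlinarith
  calc -(c * ‖a‖) = ((n : ℝ) + 1) * -(c / ((n : ℝ) + 1) * ‖a‖) := by field_simp
    _ ≤ ((n : ℝ) + 1) * (inner ℝ a (p n - q) + ‖p n - q‖ ^ 2 / 2) := by gcongr
    _ = _ := by ring

theorem exists_proj_infDist [CompleteSpace H] {K : Set H} (hne : K.Nonempty) (hK : IsClosed K)
    (hKc : Convex ℝ K) (q : H) : ∃ π ∈ K, Metric.infDist q K = ‖q - π‖ ∧
      ∀ x ∈ K, inner ℝ (q - π) (x - π) ≤ 0 := by
  obtain ⟨π, hπ, heq⟩ := exists_norm_eq_iInf_of_complete_convex hne hK.isComplete hKc q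
  refine ⟨π, hπ, ?_, (norm_eq_iInf_iff_real_inner_le_zero hKc hπ).1 heq⟩
  rw [Metric.infDist_eq_iInf, heq]
  simp only [dist_eq_norm]

theorem metricProjSet_eq_singleton {K : Set H} (hKc : Convex ℝ K) {q π : H} (hπ : π ∈ K)
    (hvar : ∀ x ∈ K, inner ℝ (q - π) (x - π) ≤ 0) : metricProjSet K q = {π} := by
  have hinf : ∀ e ∈ K, Metric.infDist q K = ‖q - e‖ ↔ ∀ x ∈ K, inner ℝ (q - e) (x - e) ≤ 0 := by
    intro e he
    rw [← norm_eq_iInf_iff_real_inner_le_zero hKc he, Metric.infDist_eq_iInf]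
    simp only [dist_eq_norm]
    exact eq_comm
  ext e
  simp only [metricProjSet, mem_ofPred_eq, mem_singleton_iff]
  constructor
  · rintro ⟨he, h⟩
    have h1 := (hinf e he).1 h π hπ
    have h2 := hvar e he
    have h3 : inner ℝ (e - π) (e - π) ≤ 0 := by
      have : inner ℝ (e - π) (e - π) = inner ℝ (q - π) (e - π) + inner ℝ (q - e) (π - e) := by
        have e1 : e - π = (q - π) - (q - e) := by abel
        have e2 : π - e = -(e - π) := by abel
        rw [e2, inner_neg_right, ← sub_eq_add_neg, ← inner_sub_left, ← e1]
      linarith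
    exact sub_eq_zero.1 (inner_self_eq_zero.1 (le_antisymm h3 real_inner_self_nonneg))
  · rintro rfl
    exact ⟨hπ, (hinf e hπ).2 hvar⟩

/-- Banach–Alaoglu and Riesz representation; an ultrafilter converges in a compact set without
passing to subsequences. -/
theorem exists_weak_limit [CompleteSpace H] {ι : Type*} (f : Ultrafilter ι) {ζ : ι → H} {C : ℝ}
    (hζ : ∀ k, ‖ζ k‖ ≤ C) : ∃ z : H, ∀ w, Tendsto (fun k => inner ℝ (ζ k) w) f (𝓝 (inner ℝ z w)) := by
  have hc := WeakDual.isCompact_closedBall (𝕜 := ℝ) (E := H) 0 C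
  let φ : ι → WeakDual ℝ H := fun k => StrongDual.toWeakDual (InnerProductSpace.toDual ℝ H (ζ k))
  obtain ⟨ψ, -, hψ⟩ := hc.ultrafilter_le_nhds (f.map φ) (by
    rw [Ultrafilter.coe_map, le_principal_iff, mem_map]
    refine univ_mem' fun k => ?_
    simpa [φ] using hζ k)
  refine ⟨(InnerProductSpace.toDual ℝ H).symm (WeakDual.toStrongDual ψ), fun w => ?_⟩
  have h1 : Tendsto φ f (𝓝 ψ) := hψ
  have h2 := ((WeakDual.eval_continuous w).tendsto ψ).comp h1
  rw [InnerProductSpace.toDual_symm_apply]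
  exact h2

/-- A weakly null family of vectors, asymptotically nonnegative on a finite codimensional set,
is strongly null. -/
theorem IsFiniteCodimensional.tendsto_norm_zero [CompleteSpace H] {D : Set H}
    (hD : IsFiniteCodimensional D) {ι : Type*} {l : Filter ι} {x : ι → H}
    (hw : ∀ w, Tendsto (fun k => inner ℝ (x k) w) l (𝓝 0))
    (hlb : ∀ ε > 0, ∀ᶠ k in l, ∀ d ∈ D, -ε ≤ inner ℝ (x k) d) :
    Tendsto (fun k => ‖x k‖) l (𝓝 0) := by
  obtain ⟨x₀, -, hD⟩ := hD
  have hYc : IsClosed (closedSpanSub D x₀ : Set H) := Submodule.isClosed_topologicalClosure _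
  generalize closedSpanSub D x₀ = Y at hD hYc
  obtain ⟨hfin, p₀, hp₀⟩ := hD
  have : CompleteSpace Y := hYc.completeSpace_coe
  have : FiniteDimensional ℝ Yᗮ :=
    (Submodule.quotientEquivOfIsCompl Y Yᗮ Y.isCompl_orthogonal
      ).finiteDimensional
  obtain ⟨r, hr, hball⟩ := Metric.isOpen_iff.1 isOpen_interior p₀ hp₀
  -- The translation by `x₀` costs `inner (x k) x₀`, which tends to zero, and a closed half-space
  -- containing a set contains its closed convex hull.
  have hcl : ∀ ε > 0, ∀ᶠ k in l, ∀ p ∈ closure (convexHull ℝ ((fun d => d - x₀) '' D)),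
      -ε ≤ inner ℝ (x k) p := by
    intro ε hε
    filter_upwards [hlb (ε / 2) (by positivity),
      (hw x₀).eventually (gt_mem_nhds (by positivity : 0 < ε / 2))] with k h1 h2
    have hsub : closure (convexHull ℝ ((fun d => d - x₀) '' D)) ⊆ {p | -ε ≤ inner ℝ (x k) p} := by
      refine closure_minimal (convexHull_min ?_ ?_) ?_
      · rintro _ ⟨d, hd, rfl⟩
        have := h1 d hd
        rw [mem_ofPred_eq, inner_sub_right]
        linarith
      · exact convex_halfSpace_ge ⟨fun a b => inner_add_right _ _ _,
          fun c a => real_inner_smul_right _ _ _⟩ _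
      · exact isClosed_le continuous_const (by fun_prop)
    exact fun p hp => hsub hp
  have hPY : Tendsto (fun k => ‖Y.starProjection (x k)‖) l (𝓝 0) := by
    rw [Metric.tendsto_nhds]
    intro ε hε
    filter_upwards [hcl (ε * r / 8) (by positivity),
      (hw p₀).eventually (gt_mem_nhds (by positivity : 0 < ε * r / 8))] with k h1 h2
    rw [Real.dist_0_eq_abs, abs_norm]
    set P := Y.starProjection (x k) with hP
    rcases eq_or_ne P 0 with h0 | h0
    · rw [h0, norm_zero]; exact hε
    have hPn : 0 < ‖P‖ := norm_pos_iff.2 h0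
    have hPY : P ∈ Y := Submodule.starProjection_apply_mem _ _
    -- A move by `r / 2` from the interior point against `P` stays in the hull and lowers the
    -- pairing with `x k` by `(r / 2)‖P‖`. The lower bound on the hull and the weak limit at `p₀`
    -- thus force `‖P‖` to be small.
    let y : Y := p₀ - (r / (2 * ‖P‖)) • ⟨P, hPY⟩
    have hy : y ∈ Metric.ball p₀ r := by
      rw [Metric.mem_ball, dist_eq_norm]
      simp only [y, sub_sub_cancel_left, norm_neg, norm_smul]
      rw [Real.norm_of_nonneg (by positivity)]
      change r / (2 * ‖P‖) * ‖P‖ < r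
      field_simp
      linarith
    have hy' := interior_subset (hball hy)
    have h3 := h1 y hy'
    have h4 : inner ℝ (x k) P = ‖P‖ ^ 2 := by
      have h5 : inner ℝ (x k - P) P = 0 :=
        Submodule.starProjection_inner_eq_zero (K := Y) (x k) P hPY
      rw [inner_sub_left, real_inner_self_eq_norm_sq] at h5
      linarith
    have h6 : inner ℝ (x k) (y : H) = inner ℝ (x k) (p₀ : H) - r / 2 * ‖P‖ := by
      simp only [y, Submodule.coe_sub, Submodule.coe_smul, inner_sub_right, real_inner_smul_right,
        h4]
      field_simp
    rw [h6] at h3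
    nlinarith
  -- The orthogonal complement is finite dimensional, where weak and strong convergence agree.
  have hPO : Tendsto (fun k => ‖Yᗮ.starProjection (x k)‖) l (𝓝 0) := by
    let b := stdOrthonormalBasis ℝ Yᗮ
    have h1 : ∀ k, ‖Yᗮ.starProjection (x k)‖ ^ 2 = ∑ i, (inner ℝ (x k) (b i : H)) ^ 2 := by
      intro k
      have h2 := b.sum_sq_norm_inner_left (Yᗮ.orthogonalProjectionOnto (x k))
      rw [Submodule.starProjection_apply, ← Submodule.coe_norm, ← h2]
      refine Finset.sum_congr rfl fun i _ => ?_
      rw [Real.norm_eq_abs, sq_abs, Submodule.inner_orthogonalProjectionOnto_eq_of_mem_right]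
    have h3 : Tendsto (fun k => ‖Yᗮ.starProjection (x k)‖ ^ 2) l (𝓝 0) := by
      simp only [h1]
      rw [← Finset.sum_const_zero (s := (Finset.univ : Finset (Fin (Module.finrank ℝ Yᗮ))))]
      refine tendsto_finsetSum _ fun i _ => ?_
      simpa using (hw (b i : H)).pow 2
    have h4 := h3.sqrt
    simpa using h4
  have hadd := hPY.add hPO
  rw [add_zero] at hadd
  refine squeeze_zero (fun _ => norm_nonneg _) (fun k => ?_) hadd
  calc ‖x k‖ = ‖Y.starProjection (x k) + Yᗮ.starProjection (x k)‖ := by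
        rw [Submodule.starProjection_add_starProjection_orthogonal]
    _ ≤ _ := norm_add_le _ _

end Hilbert

/-! ### The running cost as an additional state. -/

section Augmentation

variable {X U : Type*} [NormedAddCommGroup X] [NormedSpace ℝ X]

/-- The semigroup `id × S` on `ℝ × X`, which carries the running cost as an additional state. -/
noncomputable def C0Semigroup.augment (S : C0Semigroup X) : C0Semigroup (ℝ × X) where
  toFun t := (ContinuousLinearMap.id ℝ ℝ).prodMap (S.toFun t)
  map_zero := by rw [S.map_zero]; rfl
  map_add s t hs ht := by rw [S.map_add s t hs ht]; rfl
  tendsto_zero p := (tendsto_const_nhds (x := p.1)).prodMk_nhds (S.tendsto_zero p.2)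

theorem IsMildSolution.augment [CompleteSpace X] {S : C0Semigroup X} {T : ℝ} {φ : ℝ → X → X}
    {x₀ : X} {y : ℝ → X} (hy : IsMildSolution S T φ x₀ y) {c : ℝ → ℝ}
    (hc : IntegrableOn c (Ioo 0 T)) {Φ : ℝ → ℝ × X → ℝ × X}
    (hΦ : ∀ s ∈ Ioo 0 T, ∀ r, Φ s (r, y s) = (c s, φ s (y s))) :
    IsMildSolution S.augment T Φ (0, x₀) (fun t => (∫ s in (0 : ℝ)..t, c s, y t)) := by
  refine ⟨ContinuousOn.prodMk ?_ hy.1, ?_, ?_⟩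
  · rcases le_or_gt 0 T with hT | hT
    · have := intervalIntegral.continuousOn_primitive_interval (μ := volume) (f := c) (a := 0)
        (b := T) (by
          rw [uIcc_of_le hT, integrableOn_Icc_iff_integrableOn_Ioo]; exact hc)
      rwa [uIcc_of_le hT] at this
    · rw [Icc_eq_empty (not_le.2 hT)]; exact continuousOn_empty _
  · refine IntegrableOn.congr_fun (f := fun s => (c s, φ s (y s))) ?_
      (fun s hs => (hΦ s hs _).symm) measurableSet_Ioo
    exact Integrable.prodMk hc hy.2.1
  · intro t ht
    have hi := S.intervalIntegrable_conv hy.2.1 ht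
    have hci : IntegrableOn c (Ioo 0 t) := hc.mono_set (Ioo_subset_Ioo_right ht.2)
    rw [intervalIntegrable_iff_integrableOn_Ioo_of_le ht.1] at hi
    rw [← setIntegral_Ioo_eq_intervalIntegral ht.1]
    beta_reduce
    have e : ∫ s in Ioo 0 t, S.augment.toFun (t - s) (Φ s (∫ r in (0 : ℝ)..s, c r, y s))
        = ∫ s in Ioo 0 t, (c s, S.toFun (t - s) (φ s (y s))) := by
      refine setIntegral_congr_fun measurableSet_Ioo fun s hs => ?_
      rw [hΦ s ⟨hs.1, hs.2.trans_le ht.2⟩]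
      rfl
    rw [e, integral_pair hci hi, hy.2.2 t ht, setIntegral_Ioo_eq_intervalIntegral ht.1,
      setIntegral_Ioo_eq_intervalIntegral ht.1]
    change _ = ((0 : ℝ), S.toFun t x₀) + _
    rw [Prod.mk_add_mk, zero_add]

/-- The drift `(g, F)` on `ℝ × X`. -/
def augmentedDrift (F : ℝ → X → U → X) (g : ℝ → X → U → ℝ) : ℝ → ℝ × X → U → ℝ × X :=
  fun t p u => (g t p.2 u, F t p.2 u)

variable [TopologicalSpace U] {T : ℝ} {F : ℝ → X → U → X} {g : ℝ → X → U → ℝ}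

theorem HypA1.hasFDerivAt_augmentedDrift (h : HypA1 T F g) {t : ℝ} (ht : t ∈ Icc 0 T)
    (p : ℝ × X) (u : U) :
    HasFDerivAt (fun q => augmentedDrift F g t q u)
      (((fderiv ℝ (fun y => g t y u) p.2).comp (ContinuousLinearMap.snd ℝ ℝ X)).prod
        ((fderiv ℝ (fun y => F t y u) p.2).comp (ContinuousLinearMap.snd ℝ ℝ X))) p :=
  ((((h.differentiable_g t ht u).differentiable one_ne_zero) p.2).hasFDerivAt.comp p
    hasFDerivAt_snd).prodMk
  ((((h.differentiable_F t ht u).differentiable one_ne_zero) p.2).hasFDerivAt.comp p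
    hasFDerivAt_snd)

/-- The product `ℝ × X` carries the maximum norm, so the pair `(g, F)` inherits the constant `L` of
its components. -/
theorem HypA1.exists_driftHyp (h : HypA1 T F g) :
    ∃ L, DriftHyp T L F ∧ DriftHyp T L (augmentedDrift F g) := by
  obtain ⟨L, hL, hb⟩ := h.bound
  have hF : ∀ t ∈ Icc 0 T, ∀ y u, ‖fderiv ℝ (fun x => F t x u) y‖ ≤ L := fun t ht y u => by
    have := hb t ht y u
    linarith [norm_nonneg (fderiv ℝ (fun x => g t x u) y), norm_nonneg (F t 0 u),
      abs_nonneg (g t 0 u)]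
  have hg : ∀ t ∈ Icc 0 T, ∀ y u, ‖fderiv ℝ (fun x => g t x u) y‖ ≤ L := fun t ht y u => by
    have := hb t ht y u
    linarith [norm_nonneg (fderiv ℝ (fun x => F t x u) y), norm_nonneg (F t 0 u),
      abs_nonneg (g t 0 u)]
  have hF0 : ∀ t ∈ Icc 0 T, ∀ u, ‖F t 0 u‖ ≤ L := fun t ht u => by
    have := hb t ht 0 u
    linarith [norm_nonneg (fderiv ℝ (fun x => F t x u) 0),
      norm_nonneg (fderiv ℝ (fun x => g t x u) 0), abs_nonneg (g t 0 u)]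
  have hg0 : ∀ t ∈ Icc 0 T, ∀ u, ‖g t 0 u‖ ≤ L := fun t ht u => by
    have := hb t ht 0 u
    rw [Real.norm_eq_abs]
    linarith [norm_nonneg (fderiv ℝ (fun x => F t x u) 0),
      norm_nonneg (fderiv ℝ (fun x => g t x u) 0), norm_nonneg (F t 0 u)]
  refine ⟨L, ⟨hL.le, h.measurable_F, h.differentiable_F, h.continuous_F, h.continuous_Fy, hF,
    hF0⟩, ⟨hL.le, fun p u => (h.measurable_g p.2 u).prodMk (h.measurable_F p.2 u),
    fun t ht u => ?_, fun t ht => ?_, fun t ht => ?_, fun t ht p u => ?_, fun t ht u => ?_⟩⟩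
  · exact ((h.differentiable_g t ht u).comp contDiff_snd).prodMk
      ((h.differentiable_F t ht u).comp contDiff_snd)
  · have e : Continuous fun p : (ℝ × X) × U => (p.1.2, p.2) := by fun_prop
    exact ((h.continuous_g t ht).comp e).prodMk ((h.continuous_F t ht).comp e)
  · have e : Continuous fun p : (ℝ × X) × U => (p.1.2, p.2) := by fun_prop
    have h1 := (continuous_const (y := ContinuousLinearMap.inl ℝ ℝ X)).clm_comp
      (((h.continuous_gy t ht).comp e).clm_comp
        (continuous_const (y := ContinuousLinearMap.snd ℝ ℝ X)))
    have h2 := (continuous_const (y := ContinuousLinearMap.inr ℝ ℝ X)).clm_comp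
      (((h.continuous_Fy t ht).comp e).clm_comp
        (continuous_const (y := ContinuousLinearMap.snd ℝ ℝ X)))
    refine (h1.add h2).congr fun p => ?_
    rw [(h.hasFDerivAt_augmentedDrift ht p.1 p.2).fderiv]
    ext q <;> simp
  · rw [(h.hasFDerivAt_augmentedDrift ht p u).fderiv]
    refine ContinuousLinearMap.opNorm_le_bound _ hL.le fun q => ?_
    have hq : ‖q.2‖ ≤ ‖q‖ := norm_snd_le q
    have h1 := (fderiv ℝ (fun y => g t y u) p.2).le_of_opNorm_le (hg t ht _ u) q.2
    have h2 := (fderiv ℝ (fun y => F t y u) p.2).le_of_opNorm_le (hF t ht _ u) q.2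
    have h3 := mul_le_mul_of_nonneg_left hq hL.le
    exact max_le (h1.trans h3) (h2.trans h3)
  · exact max_le (hg0 t ht u) (hF0 t ht u)

end Augmentation

section Augmentation

variable {X U : Type*} [NormedAddCommGroup X] [NormedSpace ℝ X] [CompleteSpace X]
  [MetricSpace U] [TopologicalSpace.SeparableSpace U] [MeasurableSpace U] [BorelSpace U]
  {T : ℝ} {F : ℝ → X → U → X} {g : ℝ → X → U → ℝ}

theorem IsTrajectory.augment (h : HypA1 T F g) {S : C0Semigroup X} {y₀ : X} {u : ℝ → U}
    {y : ℝ → X} (hu : u ∈ controls U T) (hy : IsTrajectory S T F y₀ u y) :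
    IsTrajectory S.augment T (augmentedDrift F g) (0, y₀) u
      (fun t => (∫ s in (0 : ℝ)..t, g s (y s) (u s), y t)) := by
  obtain ⟨L, -, hA⟩ := h.exists_driftHyp
  have hp : ContinuousOn (fun t => ((0 : ℝ), y t)) (Icc 0 T) := continuousOn_const.prodMk hy.1
  obtain ⟨R, hR⟩ := isCompact_Icc.exists_bound_of_continuousOn hp
  have hi : IntegrableOn (fun s => augmentedDrift F g s (0, y s) (u s)) (Ioo 0 T) :=
    integrableOn_Ioo_of_bound (hA.aestronglyMeasurable_comp
      (integrableOn_Ioo_of_continuousOn hp).aestronglyMeasurable hu) fun s hs =>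
      (hA.growth (Ioo_subset_Icc_self hs) _ _).trans (add_le_add_left
        (mul_le_mul_of_nonneg_left (hR s (Ioo_subset_Icc_self hs)) hA.nonneg) L)
  exact IsMildSolution.augment (c := fun s => g s (y s) (u s)) hy
    (Integrable.fst hi) fun s _ r => rfl

/-- The end point of the augmented variation is `(ξ⁰, ξ(T))`, so it captures `𝒱(ū)` up to the factor
`1 / T`. The first component `a` of the reference curve is arbitrary because the augmented drift
does not depend on it. -/
theorem IsVariation.augment (h : HypA1 T F g) {S : C0Semigroup X} {u v : ℝ → U}
    {y ξ : ℝ → X} (a : ℝ → ℝ) (hu : u ∈ controls U T) (hv : v ∈ controls U T)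
    (hy : ContinuousOn y (Icc 0 T)) (hξ : IsVariation S T F u y v ξ) :
    IsVariation S.augment T (augmentedDrift F g) u (fun t => (a t, y t)) v
      (fun t => (∫ s in (0 : ℝ)..t, (fderiv ℝ (fun z => g s z (u s)) (y s) (ξ s)
        + g s (y s) (v s) - g s (y s) (u s)), ξ t)) := by
  obtain ⟨L, -, hA⟩ := h.exists_driftHyp
  have hL := hA.nonneg
  have hp : ContinuousOn (fun t => ((0 : ℝ), y t)) (Icc 0 T) := continuousOn_const.prodMk hy
  have hq : ContinuousOn (fun t => ((0 : ℝ), ξ t)) (Icc 0 T) := continuousOn_const.prodMk hξ.1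
  obtain ⟨R, hR⟩ := isCompact_Icc.exists_bound_of_continuousOn hp
  obtain ⟨Q, hQ⟩ := isCompact_Icc.exists_bound_of_continuousOn hq
  have hpm := (integrableOn_Ioo_of_continuousOn hp).aestronglyMeasurable
  have hqm := (integrableOn_Ioo_of_continuousOn hq).aestronglyMeasurable
  have hi : ∀ {w}, w ∈ controls U T →
      IntegrableOn (fun s => augmentedDrift F g s (0, y s) (w s)) (Ioo 0 T) := fun hw =>
    integrableOn_Ioo_of_bound (hA.aestronglyMeasurable_comp hpm hw) fun s hs =>
      (hA.growth (Ioo_subset_Icc_self hs) _ _).trans (add_le_add_left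
        (mul_le_mul_of_nonneg_left (hR s (Ioo_subset_Icc_self hs)) hL) L)
  have hd : IntegrableOn (fun s => fderiv ℝ (fun z => augmentedDrift F g s z (u s)) (0, y s)
      (0, ξ s)) (Ioo 0 T) :=
    integrableOn_Ioo_of_bound (hA.aestronglyMeasurable_fderiv hpm hu hqm) (C := L * Q)
      fun s hs => (ContinuousLinearMap.le_of_opNorm_le _
        (hA.norm_fderiv_le s (Ioo_subset_Icc_self hs) _ _) _).trans
        (mul_le_mul_of_nonneg_left (hQ s (Ioo_subset_Icc_self hs)) hL)
  have hfd : ∀ s ∈ Ioo 0 T, ∀ b r, fderiv ℝ (fun z => augmentedDrift F g s z (u s)) (b, y s)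
      (r, ξ s) = (fderiv ℝ (fun z => g s z (u s)) (y s) (ξ s),
        fderiv ℝ (fun z => F s z (u s)) (y s) (ξ s)) := fun s hs b r => by
    rw [(h.hasFDerivAt_augmentedDrift (Ioo_subset_Icc_self hs) (b, y s) (u s)).fderiv]
    rfl
  have hc : IntegrableOn (fun s => fderiv ℝ (fun z => g s z (u s)) (y s) (ξ s)
      + g s (y s) (v s) - g s (y s) (u s)) (Ioo 0 T) := by
    refine IntegrableOn.congr_fun (f := fun s =>
      (fderiv ℝ (fun z => augmentedDrift F g s z (u s)) (0, y s) (0, ξ s)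
        + augmentedDrift F g s (0, y s) (v s) - augmentedDrift F g s (0, y s) (u s)).1)
      (Integrable.fst ((hd.add (hi hv)).sub (hi hu))) (fun s hs => ?_) measurableSet_Ioo
    simp only
    rw [hfd s hs]
    rfl
  refine IsMildSolution.augment hξ hc fun s hs r => ?_
  rw [hfd s hs]
  rfl

end Augmentation

/-! ### Penalization and the multiplier rule. -/

/-- Ekeland's principle applied to the distance of the end point to a closed convex set. -/
theorem DriftHyp.exists_penalized_control {X U H : Type*} [NormedAddCommGroup X] [NormedSpace ℝ X]
    [CompleteSpace X] [MetricSpace U] [TopologicalSpace.SeparableSpace U] [MeasurableSpace U]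
    [BorelSpace U] [NormedAddCommGroup H] [InnerProductSpace ℝ H] [CompleteSpace H]
    {T L : ℝ} {F : ℝ → X → U → X} (h : DriftHyp T L F) (hT : 0 < T) {S : C0Semigroup X} {y₀ : X}
    (e : X →L[ℝ] H) {K : Set H} (hne : K.Nonempty) (hK : IsClosed K) (hKc : Convex ℝ K) (r : X)
    {u : ℝ → U} {y : ℝ → X} (hu : u ∈ controls U T) (hy : IsTrajectory S T F y₀ u y) {η : ℝ}
    (hη : 0 < η) (hle : Metric.infDist (e (y T - r)) K ≤ η ^ 2) :
    ∃ w ∈ controls U T, ∃ z, IsTrajectory S T F y₀ w z ∧ ekelandDist T w u ≤ η ∧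
      ∃ π ∈ K, ‖e (z T - r) - π‖ ≤ η ^ 2 ∧ (∀ x ∈ K, inner ℝ (e (z T - r) - π) (x - π) ≤ 0) ∧
      ∀ v ∈ controls U T, ∀ ξ, IsVariation S T F w z v ξ →
        -(η * (2 * T) * ‖e (z T - r) - π‖) ≤ inner ℝ (e (z T - r) - π) (e (ξ T)) := by
  choose Y hY using fun w : ControlSpace U T => h.exists_trajectory hT.le S y₀ w.2
  obtain ⟨C, hC0, hC⟩ := h.exists_trajectory_lipschitz hT.le S y₀
  have hTT : T ∈ Icc 0 T := ⟨hT.le, le_rfl⟩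
  let q : ControlSpace U T → H := fun w => e (Y w T - r)
  have hqc : Continuous q := by
    have : LipschitzWith ⟨C, hC0⟩ fun w => Y w T := LipschitzWith.of_dist_le_mul fun w w' => by
      rw [dist_eq_norm]
      exact hC _ _ _ _ (hY w) (hY w') T hTT
    exact e.continuous.comp (this.continuous.sub continuous_const)
  obtain ⟨w, hw1, hw2⟩ := ekeland_variational_principle (f := fun w => Metric.infDist (q w) K)
    ((Metric.continuous_infDist_pt K).comp hqc).lowerSemicontinuous
    ⟨0, by rintro _ ⟨w, rfl⟩; exact Metric.infDist_nonneg⟩ ⟨u, hu⟩ hη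
  have hqu : q ⟨u, hu⟩ = e (y T - r) := by
    simp only [q]
    rw [h.trajectory_unique hT.le (hY ⟨u, hu⟩) hy hTT]
  rw [hqu] at hw1
  have hd0 : 0 ≤ dist w ⟨u, hu⟩ := dist_nonneg
  have hi0 : 0 ≤ Metric.infDist (q w) K := Metric.infDist_nonneg
  obtain ⟨π, hπ, hinf, hvar⟩ := exists_proj_infDist hne hK hKc (q w)
  refine ⟨w.1, w.2, Y w, hY w, ?_, π, hπ, ?_, hvar, ?_⟩
  · have h1 : η * dist w ⟨u, hu⟩ ≤ η * η := by nlinarith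
    exact le_of_mul_le_mul_left h1 hη
  · change ‖q w - π‖ ≤ _
    rw [← hinf]
    nlinarith [mul_nonneg hη.le hd0]
  · intro v hv ξ hξ
    -- The Ekeland inequality is tested on the spikes at `w`, at distance at most `2T / (n + 1)`;
    -- hence the slope `η · 2T`.
    obtain ⟨s, hs, hsd, hlim⟩ := h.exists_spike_sequence hT w.2 hv (hY w) hξ
    have h1 := hlim (fun n => Y ⟨s n, hs n⟩) fun n => hY ⟨s n, hs n⟩
    refine neg_mul_norm_le_inner_of_infDist_le (p := fun n => q ⟨s n, hs n⟩) hπ hinf ?_ fun n => ?_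
    · refine ((e.continuous.tendsto _).comp h1).congr fun n => ?_
      simp only [q, Function.comp_apply, map_smul, map_sub, sub_sub_sub_cancel_right]
    · refine (hw2 ⟨s n, hs n⟩).trans (add_le_add le_rfl ?_)
      rw [mul_div_assoc]
      exact mul_le_mul_of_nonneg_left (hsd n) hη.le

theorem mainTheorem6 {X U : Type*} [NormedAddCommGroup X] [InnerProductSpace ℝ X]
    [CompleteSpace X] [MetricSpace U] [TopologicalSpace.SeparableSpace U] [MeasurableSpace U]
    [BorelSpace U] (T : ℝ) (hT : 0 < T)
    (A : X →ₗ.[ℝ] X) (S : C0Semigroup X) (hA : IsGenerator A S)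
    (F : ℝ → X → U → X) (g : ℝ → X → U → ℝ) (hFg : HypA1 T F g) (y₀ : X)
    (E : Set X) (hE : IsClosed E) (hEc : Convex ℝ E)
    (ub : ℝ → U) (yb : ℝ → X) (hopt : IsOptimalPair S T F g y₀ E ub yb)
    (hcodim : IsFiniteCodimensional (reachableSet S T F g ub yb - E)) :
    ∃ (z₀ : ℝ) (z : StrongDual ℝ X), (z₀, z) ≠ 0 ∧
      (∀ p ∈ variationSet S T F g ub yb, 0 ≤ z₀ * p.1 + z p.2) ∧
      (∀ x ∈ E, z (x - yb T) ≤ 0) ∧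
      (z₀ ≠ 0 → ∃ z' : StrongDual ℝ X,
        ∀ p ∈ variationSet S T F g ub yb, 0 ≤ p.1 + z' p.2) ∧
      (z ≠ 0 → ∃ (u : ℕ → ℝ → U) (y : ℕ → ℝ → X) (e : ℕ → X),
        (∀ k, u k ∈ controls U T) ∧
        (∀ k, IsTrajectory S T F y₀ (u k) (y k)) ∧
        Tendsto (fun k => ekelandDist T (u k) ub) atTop (𝓝 0) ∧
        (∀ k, y k T ∉ E) ∧
        Tendsto (fun k => Metric.infDist (y k T) E) atTop (𝓝 0) ∧
        Tendsto (fun k => cost T g (u k) (y k)) atTop (𝓝 (cost T g ub yb)) ∧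
        (∀ k, metricProjSet E (y k T) = {e k}) ∧
        Tendsto e atTop (𝓝 (yb T)) ∧
        ∀ k, 0 < inner ℝ ((InnerProductSpace.toDual ℝ X).symm z) (y k T - e k)) := by
  obtain ⟨L, hF, hFa⟩ := hFg.exists_driftHyp
  have hTT : T ∈ Icc 0 T := ⟨hT.le, le_rfl⟩
  have hub := hopt.control
  have hyb := hopt.trajectory
  have hyba := IsTrajectory.augment hFg hub hyb
  set Jb := cost T g ub yb with hJb
  -- the Hilbert space `ℝ × X` and the convex set `(-∞, 0] × E`
  let e : (ℝ × X) ≃L[ℝ] WithLp 2 (ℝ × X) := (WithLp.prodContinuousLinearEquiv 2 ℝ ℝ X).symm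
  have hin : ∀ (h : WithLp 2 (ℝ × X)) (p : ℝ × X),
      inner ℝ h (e p) = (e.symm h).1 * p.1 + inner ℝ (e.symm h).2 p.2 := by
    intro h p
    rw [WithLp.prod_inner_apply]
    change p.1 * (e.symm h).1 + _ = _
    rw [mul_comm]
    rfl
  let K : Set (WithLp 2 (ℝ × X)) := {h | (e.symm h).1 ≤ 0 ∧ (e.symm h).2 ∈ E}
  have hKe : ∀ p : ℝ × X, e p ∈ K ↔ p.1 ≤ 0 ∧ p.2 ∈ E := fun p => by
    simp only [K, mem_ofPred_eq, e.symm_apply_apply]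
  have hKcl : IsClosed K :=
    (isClosed_Iic.preimage (continuous_fst.comp e.symm.continuous)).inter
      (hE.preimage (continuous_snd.comp e.symm.continuous))
  have hKc : Convex ℝ K :=
    ((convex_Iic (𝕜 := ℝ) (0 : ℝ)).prod hEc).linear_preimage
      (e.symm : WithLp 2 (ℝ × X) →ₗ[ℝ] ℝ × X)
  have hKne : K.Nonempty := ⟨e (0, yb T), (hKe _).2 ⟨le_rfl, hopt.endpoint⟩⟩
  have hnorm1 : ∀ a : ℝ, ‖e (a, 0)‖ = |a| := by
    intro a
    have h1 := hin (e (a, 0)) (a, 0)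
    rw [real_inner_self_eq_norm_sq, e.symm_apply_apply] at h1
    simp only [inner_zero_right, add_zero] at h1
    rw [← abs_norm, ← sq_eq_sq_iff_abs_eq_abs, h1, sq]
  -- penalized problems
  let η : ℕ → ℝ := fun k => (1 / 2) ^ k
  have hη : ∀ k, 0 < η k := fun k => by positivity
  have hη0 : Tendsto η atTop (𝓝 0) := tendsto_pow_atTop_nhds_zero_of_lt_one (by norm_num)
    (by norm_num)
  -- The shift demands a cost lower than the optimal one by `η k ^ 2`; the optimal pair itself
  -- misses this by no more than `η k ^ 2`. The map `e` passes from the maximum norm to the Hilbert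
  -- norm, in which projections are taken.
  have hpen := fun k => hFa.exists_penalized_control hT (S := S.augment) (y₀ := (0, y₀))
    (e : (ℝ × X) →L[ℝ] WithLp 2 (ℝ × X)) hKne hKcl hKc (Jb - η k ^ 2, 0) hub hyba (hη k) (by
      refine (Metric.infDist_le_dist_of_mem ((hKe (0, yb T)).2 ⟨le_rfl, hopt.endpoint⟩)).trans ?_
      rw [dist_eq_norm]
      change ‖e ((Jb, yb T) - (Jb - η k ^ 2, 0)) - e (0, yb T)‖ ≤ _
      rw [← map_sub]
      have : (Jb, yb T) - (Jb - η k ^ 2, (0 : X)) - (0, yb T) = (η k ^ 2, 0) := by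
        ext <;> simp
      rw [this, hnorm1, abs_of_nonneg (by positivity)])
  choose uk huk za hza hdk π hπ hπn hvar hstep using hpen
  simp only [ContinuousLinearEquiv.coe_coe] at hπn hvar hstep
  choose yk hyk using fun k => hF.exists_trajectory hT.le S y₀ (huk k)
  have hzaT : ∀ k, za k T = (cost T g (uk k) (yk k), yk k T) := fun k =>
    hFa.trajectory_unique hT.le (hza k) (IsTrajectory.augment hFg (huk k) (hyk k)) hTT
  have hsum : Summable fun k => ekelandDist T (uk k) ub :=
    Summable.of_nonneg_of_le (fun k => ekelandDist_nonneg _ _ _) hdk summable_geometric_two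
  have hzalim : Tendsto (fun k => za k T) atTop (𝓝 (Jb, yb T)) := by
    obtain ⟨C, hC0, hC⟩ := hFa.exists_trajectory_lipschitz hT.le S.augment (0, y₀)
    rw [tendsto_iff_norm_sub_tendsto_zero]
    exact squeeze_zero (fun _ => norm_nonneg _) (fun k => hC _ _ _ _ (hza k) hyba T hTT)
      (by simpa using hsum.tendsto_atTop_zero.const_mul C)
  simp only [hzaT] at hzalim
  have hcost : Tendsto (fun k => cost T g (uk k) (yk k)) atTop (𝓝 Jb) :=
    (continuous_fst.tendsto _).comp hzalim
  have hyT : Tendsto (fun k => yk k T) atTop (𝓝 (yb T)) :=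
    (continuous_snd.tendsto _).comp hzalim
  let D : ℕ → WithLp 2 (ℝ × X) := fun k => e (za k T - (Jb - η k ^ 2, 0)) - π k
  let N : ℕ → ℝ := fun k => ‖D k‖
  let ek : ℕ → X := fun k => (e.symm (π k)).2
  have hek : ∀ k, ek k ∈ E := fun k => (hπ k).2
  have hDs : ∀ k, (e.symm (D k)).2 = yk k T - ek k := fun k => by
    simp only [D, map_sub, e.symm_apply_apply, hzaT, ek]
    simp
  have hN : ∀ k, 0 < N k := by
    intro k
    -- If the shifted end point lay in `K`, the control would be admissible and strictly cheaper
    -- than the optimal one.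
    refine norm_pos_iff.2 fun h0 => ?_
    have h1 : e (za k T - (Jb - η k ^ 2, 0)) ∈ K := by
      rw [sub_eq_zero.1 h0]; exact hπ k
    rw [hKe, hzaT] at h1
    have h2 : yk k T ∈ E := by simpa using h1.2
    have h3 := hopt.optimal _ (huk k) _ (hyk k) h2
    have h4 := h1.1
    simp only [Prod.mk_sub_mk] at h4
    have := hη k
    have h5 : 0 < η k ^ 2 := by positivity
    linarith
  have hNlim : Tendsto (fun k => D k) atTop (𝓝 0) := by
    rw [tendsto_zero_iff_norm_tendsto_zero]
    exact squeeze_zero (fun _ => norm_nonneg _) hπn (by simpa using hη0.pow 2)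
  have heklim : Tendsto ek atTop (𝓝 (yb T)) := by
    have h1 : Tendsto (fun k => (e.symm (D k)).2) atTop (𝓝 0) := by
      have := ((continuous_snd.comp e.symm.continuous).tendsto 0).comp hNlim
      rwa [Function.comp_apply, map_zero] at this
    have h2 := hyT.sub h1
    rw [sub_zero] at h2
    refine h2.congr fun k => ?_
    rw [hDs]; abel
  -- normalized multipliers
  let ζ : ℕ → WithLp 2 (ℝ × X) := fun k => (N k)⁻¹ • D k
  have hζn : ∀ k, ‖ζ k‖ = 1 := fun k => by
    rw [norm_smul, norm_inv, Real.norm_of_nonneg (hN k).le]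
    exact inv_mul_cancel₀ (hN k).ne'
  have hDζ : ∀ k, D k = N k • ζ k := fun k => by
    simp only [ζ]; rw [smul_smul, mul_inv_cancel₀ (hN k).ne', one_smul]
  have hζK : ∀ k, ∀ x ∈ K, inner ℝ (ζ k) (x - π k) ≤ 0 := fun k x hx => by
    rw [real_inner_smul_left]
    exact mul_nonpos_of_nonneg_of_nonpos (inv_nonneg.2 (hN k).le) (hvar k x hx)
  let x : ℕ → X := fun k => (e.symm (ζ k)).2
  have hx : ∀ k w, inner ℝ (x k) w = inner ℝ (ζ k) (e (0, w)) := fun k w => by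
    rw [hin]; simp [x]
  have hDx : ∀ k, yk k T - ek k = N k • x k := fun k => by
    rw [← hDs, hDζ, map_smul]; rfl
  have hζfst : ∀ k, 0 ≤ (e.symm (ζ k)).1 := by
    intro k
    -- `K` is invariant under adding `(-1, 0)`, which fixes the sign of the cost multiplier.
    have h1 := hζK k (π k + e (-1, 0)) (by
      refine ⟨?_, ?_⟩
      · rw [map_add, e.symm_apply_apply, Prod.fst_add]
        linarith [(hπ k).1]
      · rw [map_add, e.symm_apply_apply, Prod.snd_add, add_zero]
        exact (hπ k).2)
    rw [add_sub_cancel_left, hin, inner_zero_right] at h1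
    linarith
  have hxE : ∀ k, ∀ p ∈ E, inner ℝ (x k) (p - ek k) ≤ 0 := by
    intro k p hp
    have h1 := hζK k (e ((e.symm (π k)).1, p)) ((hKe _).2 ⟨(hπ k).1, hp⟩)
    have h2 : e ((e.symm (π k)).1, p) - π k = e (0, p - ek k) := by
      apply e.symm.injective
      rw [map_sub, e.symm_apply_apply, e.symm_apply_apply]
      ext <;> simp [ek]
    rwa [h2, ← hx] at h1
  have hxn : ∀ k, ‖x k‖ ^ 2 = 1 - (e.symm (ζ k)).1 ^ 2 := by
    intro k
    have h1 := hin (ζ k) (e.symm (ζ k))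
    rw [e.apply_symm_apply, real_inner_self_eq_norm_sq, real_inner_self_eq_norm_sq, hζn] at h1
    change 1 ^ 2 = _ + ‖x k‖ ^ 2 at h1
    linarith
  have hxn1 : ∀ k, ‖x k‖ ≤ 1 := fun k => by
    have := hxn k
    nlinarith [sq_nonneg (e.symm (ζ k)).1, norm_nonneg (x k)]
  have hζstep : ∀ k, ∀ v ∈ controls U T, ∀ ξ, IsVariation S.augment T (augmentedDrift F g) (uk k)
      (za k) v ξ → -(η k * (2 * T)) ≤ inner ℝ (ζ k) (e (ξ T)) := by
    intro k v hv ξ hξ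
    have h1 := hstep k v hv ξ hξ
    change -(η k * (2 * T) * N k) ≤ inner ℝ (D k) (e (ξ T)) at h1
    rw [hDζ, real_inner_smul_left] at h1
    have := hN k
    have h2 : N k * (-(η k * (2 * T))) ≤ N k * inner ℝ (ζ k) (e (ξ T)) := by linarith
    exact le_of_mul_le_mul_left h2 this
  have hunif : ∀ ε > 0, ∀ᶠ k in atTop, ∀ v ∈ controls U T, ∀ ξ, IsVariation S.augment T
      (augmentedDrift F g) ub (fun t => (∫ s in (0 : ℝ)..t, g s (yb s) (ub s), yb t)) v ξ →
      -ε ≤ inner ℝ (ζ k) (e (ξ T)) := by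
    intro ε hε
    set M := ‖(e : (ℝ × X) →L[ℝ] WithLp 2 (ℝ × X))‖ with hM
    have hM0 : 0 ≤ M := hM ▸ ContinuousLinearMap.opNorm_nonneg _
    have h2 : Tendsto (fun k => η k * (2 * T)) atTop (𝓝 0) := by
      simpa using hη0.mul_const (2 * T)
    filter_upwards [hFa.eventually_variation_sub_le hT hub hyba huk hza hsum
      (by positivity : 0 < ε / (2 * (M + 1))),
      h2.eventually (gt_mem_nhds (by positivity : 0 < ε / 2))] with k hk hk2
    intro v hv ξ hξ
    obtain ⟨ξk, hξk⟩ := hFa.exists_variation hT.le S.augment (huk k) hv (hza k).1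
    have h3 := hζstep k v hv ξk hξk
    have h4 := hk v hv ξk ξ hξk hξ
    have h5 : inner ℝ (ζ k) (e (ξk T)) - inner ℝ (ζ k) (e (ξ T)) ≤ ε / 2 := by
      rw [← inner_sub_right, ← map_sub]
      refine (real_inner_le_norm _ _).trans ?_
      rw [hζn, one_mul]
      refine ((e : (ℝ × X) →L[ℝ] WithLp 2 (ℝ × X)).le_opNorm _).trans ?_
      calc M * ‖ξk T - ξ T‖ ≤ (M + 1) * (ε / (2 * (M + 1))) := by gcongr; linarith
        _ = ε / 2 := by field_simp
    linarith
  have hvarset : ∀ p ∈ variationSet S T F g ub yb, ∃ v ∈ controls U T, ∃ ξ, IsVariation S.augment T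
      (augmentedDrift F g) ub (fun t => (∫ s in (0 : ℝ)..t, g s (yb s) (ub s), yb t)) v ξ ∧
      p = (1 / T) • ξ T := by
    rintro p ⟨v, hv, ξ, hξ, rfl⟩
    exact ⟨v, hv, _, IsVariation.augment hFg _ hub hv hyb.1 hξ, rfl⟩
  -- the limit
  obtain ⟨z, hz⟩ := exists_weak_limit (hyperfilter ℕ) (ζ := ζ) (C := 1) fun k => (hζn k).le
  have hfle : (hyperfilter ℕ : Filter ℕ) ≤ atTop := Nat.hyperfilter_le_atTop
  have hxlim : ∀ w, Tendsto (fun k => inner ℝ (x k) w) (hyperfilter ℕ)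
      (𝓝 (inner ℝ (e.symm z).2 w)) := by
    intro w
    have h1 := hz (e (0, w))
    rw [hin] at h1
    simp only [mul_zero, zero_add, ← hx] at h1
    exact h1
  have halim : Tendsto (fun k => (e.symm (ζ k)).1) (hyperfilter ℕ) (𝓝 (e.symm z).1) := by
    have h1 := hz (e (1, 0))
    simp only [hin, inner_zero_right, mul_one, add_zero] at h1
    exact h1
  have hV : ∀ p ∈ variationSet S T F g ub yb,
      0 ≤ (e.symm z).1 * p.1 + inner ℝ (e.symm z).2 p.2 := by
    intro p hp
    obtain ⟨v, hv, ξ, hξ, rfl⟩ := hvarset p hp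
    have h1 : 0 ≤ inner ℝ z (e (ξ T)) := by
      refine le_of_forall_pos_le_add fun ε hε => ?_
      have h2 := ge_of_tendsto (hz (e (ξ T)))
        (hfle ((hunif ε hε).mono fun k hk => hk v hv ξ hξ))
      linarith
    rw [← hin, map_smul, real_inner_smul_right]
    positivity
  have hxek : Tendsto (fun k => inner ℝ (x k) (ek k - yb T)) atTop (𝓝 0) := by
    rw [tendsto_zero_iff_norm_tendsto_zero]
    refine squeeze_zero (fun _ => norm_nonneg _) (fun k => (norm_inner_le_norm _ _).trans
      (mul_le_of_le_one_left (norm_nonneg _) (hxn1 k))) ?_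
    exact tendsto_iff_norm_sub_tendsto_zero.1 heklim
  have hN_E : ∀ p ∈ E, inner ℝ (e.symm z).2 (p - yb T) ≤ 0 := by
    intro p hp
    refine le_of_tendsto_of_tendsto (hxlim (p - yb T)) (hxek.mono_left hfle)
      (Eventually.of_forall fun k => ?_)
    have h1 := hxE k p hp
    have h2 : p - yb T = (p - ek k) + (ek k - yb T) := by abel
    beta_reduce
    rw [h2, inner_add_right]
    linarith
  -- If both components vanish, the cost term in `hunif` is negligible because the variations are
  -- bounded by `Q`, and `inner (x k) (ek k)` tends to zero. Hence `x k` is asymptotically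
  -- nonnegative on `𝓜₁ - E` and so strongly null, against `‖x k‖ ^ 2 = 1 - (e.symm (ζ k)).1 ^ 2 →
  -- 1`. The uniformity of `hunif` in `v` is essential here.
  have hnz : ¬ ((e.symm z).1 = 0 ∧ (e.symm z).2 = 0) := by
    rintro ⟨hz1, hz2⟩
    rw [hz1] at halim
    simp only [hz2, inner_zero_left] at hxlim
    obtain ⟨Q, hQ0, hQ⟩ := hFa.exists_variation_bound hT.le S.augment ub hyba.1
    have hx0 := hcodim.tendsto_norm_zero hxlim (fun ε hε => by
      have h1 : Tendsto (fun k => (e.symm (ζ k)).1 * Q) (hyperfilter ℕ) (𝓝 0) := by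
        simpa using halim.mul_const Q
      have h2 : Tendsto (fun k => inner ℝ (x k) (ek k)) (hyperfilter ℕ) (𝓝 0) := by
        have := (hxek.mono_left hfle).add (hxlim (yb T))
        rw [add_zero] at this
        refine this.congr fun k => ?_
        rw [← inner_add_right, sub_add_cancel]
      filter_upwards [hfle (hunif (T * (ε / 3)) (by positivity)),
        h1.eventually (gt_mem_nhds (by positivity : 0 < T * (ε / 3))),
        h2.eventually (gt_mem_nhds (by positivity : 0 < ε / 3))] with k hk1 hk2 hk3
      rintro _ ⟨_, ⟨p, hp, rfl⟩, p', hp', rfl⟩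
      obtain ⟨v, hv, ξ, hξ, rfl⟩ := hvarset p hp
      have h3 := hk1 v hv ξ hξ
      rw [hin] at h3
      change _ ≤ _ + inner ℝ (x k) (ξ T).2 at h3
      have h4 : (e.symm (ζ k)).1 * (ξ T).1 ≤ (e.symm (ζ k)).1 * Q := by
        refine mul_le_mul_of_nonneg_left ?_ (hζfst k)
        exact (le_abs_self _).trans ((norm_fst_le (ξ T)).trans (hQ v ξ hξ T hTT))
      have h5 := hxE k p' hp'
      rw [inner_sub_right] at h5
      change -ε ≤ inner ℝ (x k) ((1 / T) • (ξ T).2 - p')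
      rw [inner_sub_right, real_inner_smul_right]
      have h6 : T * (-(2 * ε / 3)) ≤ inner ℝ (x k) (ξ T).2 := by linarith
      have h7 : -(2 * ε / 3) ≤ 1 / T * inner ℝ (x k) (ξ T).2 := by
        rw [one_div, ← div_eq_inv_mul, le_div_iff₀ hT]
        linarith
      linarith)
    have h1 := hx0.pow 2
    simp only [hxn] at h1
    have h2 := (halim.pow 2).const_sub 1
    have h3 := tendsto_nhds_unique h1 h2
    norm_num at h3
  refine ⟨(e.symm z).1, InnerProductSpace.toDual ℝ X (e.symm z).2, ?_, ?_, ?_, ?_, ?_⟩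
  · intro h0
    rw [Prod.mk_eq_zero, map_eq_zero_iff _ (InnerProductSpace.toDual ℝ X).injective] at h0
    exact hnz h0
  · simpa only [InnerProductSpace.toDual_apply_apply] using hV
  · simpa only [InnerProductSpace.toDual_apply_apply] using hN_E
  · intro hz0
    have hpos : 0 < (e.symm z).1 := lt_of_le_of_ne
      (ge_of_tendsto halim (Eventually.of_forall hζfst)) hz0.symm
    refine ⟨(e.symm z).1⁻¹ • InnerProductSpace.toDual ℝ X (e.symm z).2, fun p hp => ?_⟩
    have h1 := hV p hp
    rw [smul_apply, InnerProductSpace.toDual_apply_apply, smul_eq_mul]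
    have h2 : p.1 + (e.symm z).1⁻¹ * inner ℝ (e.symm z).2 p.2
        = (e.symm z).1⁻¹ * ((e.symm z).1 * p.1 + inner ℝ (e.symm z).2 p.2) := by
      field_simp
    rw [h2]
    exact mul_nonneg (inv_nonneg.2 hpos.le) h1
  · intro hz0
    have hzne : (e.symm z).2 ≠ 0 := fun h0 => hz0 (by rw [h0, map_zero])
    -- The limit of these pairings is the squared norm of the multiplier. Positivity along the
    -- ultrafilter yields infinitely many indices, hence a genuine subsequence.
    have hev : ∀ᶠ k in (hyperfilter ℕ : Filter ℕ), 0 < inner ℝ (x k) (e.symm z).2 :=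
      (hxlim (e.symm z).2).eventually (lt_mem_nhds (real_inner_self_pos.2 hzne))
    obtain ⟨φ, hφ, hφpos⟩ := extraction_of_frequently_atTop (hev.frequently.filter_mono hfle)
    have hφt := hφ.tendsto_atTop
    have hproj : ∀ k, ∀ p ∈ E, inner ℝ (yk k T - ek k) (p - ek k) ≤ 0 := fun k p hp => by
      rw [hDx, real_inner_smul_left]
      exact mul_nonpos_of_nonneg_of_nonpos (hN k).le (hxE k p hp)
    have hpos : ∀ k, 0 < inner ℝ (e.symm z).2 (yk (φ k) T - ek (φ k)) := fun k => by
      rw [hDx, real_inner_smul_right, real_inner_comm]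
      exact mul_pos (hN _) (hφpos k)
    refine ⟨fun k => uk (φ k), fun k => yk (φ k), fun k => ek (φ k), fun k => huk _,
      fun k => hyk _, hsum.tendsto_atTop_zero.comp hφt, fun k hk => ?_, ?_, hcost.comp hφt,
      fun k => metricProjSet_eq_singleton hEc (hek _) (hproj _), heklim.comp hφt, fun k => ?_⟩
    -- An end point in `E` would coincide with its projection, and the strict inequality `hpos`
    -- would fail.
    · have h1 := inner_self_eq_zero.1 (le_antisymm (hproj _ _ hk) real_inner_self_nonneg)
      have h2 := hpos k
      rw [h1, inner_zero_right] at h2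
      exact lt_irrefl _ h2
    · refine squeeze_zero (fun _ => Metric.infDist_nonneg)
        (fun k => Metric.infDist_le_dist_of_mem hopt.endpoint) ?_
      exact tendsto_iff_dist_tendsto_zero.1 (hyT.comp hφt)
    · rw [LinearIsometryEquiv.symm_apply_apply]
      exact hpos k
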